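/- Let $K$ be a field, $n\ge 0$, $S=K[x_0,\ldots,x_n]$ with the standard grading, and $\mathfrak m=(x_0,\ldots,x_n)$. Let $f_0,\ldots,f_n\in S$ be homogeneous polynomials of degrees $d_0,\ldots,d_n$ (the zero polynomial counts as homogeneous of every degree), and put $J=(f_0,\ldots,f_n)$. Suppose that $\dim S/J=1$ and that $f_1,\ldots,f_n$ is a regular sequence in $S$. Let $I=(J:\mathfrak m^{\infty})=\bigcup_{k\ge 0}(J:\mathfrak m^k)$ be the saturation of $J$. For a homogeneous ideal $L\subseteq S$ let $H_{S/L}(t)=\sum_{p\ge 0}\dim_K(S/L)_p\,t^p$ be the Hilbert series. Then $$H_{S/J}(t)=\frac{G(t)}{1-t},\qquad H_{S/I}(t)=\frac{F(t)}{1-t}$$ for (unique) polynomials $G,F\in\mathbb Z[t]$, which satisfy $G(1)\ne 0$ and $F(1)\ne 0$, and in $\mathbb Z[t,t^{-1}]$ $$G(t)=(1-t^{d_0})\prod_{j=1}^n\bigl(1+t+\cdots+t^{d_j-1}\bigr)+t^{\,\sum_{i=0}^n d_i-n}\,F(1/t).$$ Moreover, if the ring $S/I$ is Gorenstein (that is,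 Noetherian, with every localization at a maximal ideal of finite injective dimension as a module over itself), then $$G(t)=(1-t^{d_0})\prod_{j=1}^n\bigl(1+t+\cdots+t^{d_j-1}\bigr)+t^{\,\sum_{i=0}^n d_i-n-\deg F}\,F(t).$$ -/

import Mathlib

open CategoryTheory

universe u

/-- The degree `p` homogeneous component `(S / J)_p` of `S / J`, where `S = K[x_σ]` has the standard
grading: the image in `S / J` of the space of homogeneous polynomials of degree `p`.
It is the graded piece of `S / J` whenever `J` is a homogeneous ideal. -/
noncomputable def gradedPiece {σ : Type*} {K : Type*} [Field K] (J : Ideal (MvPolynomial σ K))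
    (p : ℕ) : Submodule K (MvPolynomial σ K ⧸ J) :=
  (MvPolynomial.homogeneousSubmodule σ K p).map (Ideal.Quotient.mkₐ K J).toLinearMap

/-- The Hilbert series `H_{S/J}(t) = ∑_p dim_K (S / J)_p t ^ p`, as a formal power series over `ℤ`.
It is used for finitely many variables, so that all the graded pieces are finite-dimensional. -/
noncomputable def quotientHilbertSeries {σ : Type*} {K : Type*} [Field K]
    (J : Ideal (MvPolynomial σ K)) : PowerSeries ℤ :=
  PowerSeries.mk fun p => (Module.finrank K (gradedPiece J p) : ℤ)

/-- The irrelevant maximal ideal `𝔪`, generated by all the variables. -/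
noncomputable def maxIdealOfVars (σ : Type*) (K : Type*) [Field K] : Ideal (MvPolynomial σ K) :=
  Ideal.span (Set.range MvPolynomial.X)

/-- The saturation `(J : 𝔪 ^ ∞) = ⋃_k (J : 𝔪 ^ k)` of `J` with respect to the irrelevant ideal `𝔪`
(the supremum is over an increasing chain of ideals, so it is the union). -/
noncomputable def saturationIdeal {σ : Type*} {K : Type*} [Field K]
    (J : Ideal (MvPolynomial σ K)) : Ideal (MvPolynomial σ K) :=
  ⨆ k : ℕ, J.colon ((maxIdealOfVars σ K ^ k : Ideal (MvPolynomial σ K)) : Set (MvPolynomial σ K))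

/-- A commutative ring `A` is Gorenstein if it is Noetherian and, for every maximal ideal `P`,
the local ring `A_P` has finite injective dimension as a module over itself. -/
def IsGorensteinRing (A : Type u) [CommRing A] : Prop :=
  IsNoetherianRing A ∧ ∀ (P : Ideal A) [P.IsMaximal], ∃ r : ℕ,
    HasInjectiveDimensionLE
      (ModuleCat.of (Localization.AtPrime P) (Localization.AtPrime P)) r

/-!
Write `a = (f₁, …, fₙ)`, `R = S / a` and `c = ∑ⱼ (dⱼ - 1)`, the sum being over `j ≥ 1`. From
`0 → (0 :_R f₀)(-d₀) → R(-d₀) → R → S / J → 0` and `H_R = ∏ⱼ (1 + ⋯ + t ^ (dⱼ - 1)) / (1 - t)`, the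
identity for `G` is equivalent to a duality: `(0 :_R f₀)` is a shifted dual of `S / I`, so that,
if `μ` is the eventual value of the Hilbert function of `S / I`,
`dim R_p - dim (S / (a : f₀))_p = μ - dim (S / I)_{c - 1 - p}`
(`hilbertFn_add_eq_hilbertFn_colon_add`).

Instead of canonical modules, the proof uses Artinian reductions of large degree. Neither `S / a` nor
`S / I` has a nonzero element killed by `𝔪`, so homogeneous prime avoidance gives, in each large
degree `e`, a form `h` that is a nonzerodivisor on both (`exists_isHomogeneous_regular`). Then
`S / (a + (h))` is an Artinian complete intersection with socle degree `c + e - 1`, and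
in degrees below `e` it agrees with `R`. Its socle is one-dimensional because, by Rees' theorem
(`nonempty_linearMap_equiv_ext`), it is `Ext^{n+1}(K, S)`, which can also be computed from the
variables `x₀, …, xₙ` (`hasCyclicSocle_of_isWeaklyRegular`). A one-dimensional socle makes
multiplication into the top degree a perfect pairing, so the Hilbert function is symmetric
(`hilbertFn_symm_of_hasCyclicSocle`). This property passes to `S / ((a + (h)) : f₀)`, whose Hilbert
function is read off in low degrees from `(0 :_R f₀)` and in high degrees from
`S / (J + (h))`; there `J` may be replaced by `I`, on which `h` is regular. Letting `h` vary
also shows that the Hilbert function of `S / I` is constant from degree `c` on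
(`exists_hilbertFn_eq_const`), which gives the polynomial `F`, with `F(1) = μ ≠ 0`.

If `S / I` is Gorenstein, let `B` be its localization at `𝔪`, with residue field `k`. Finite
injective dimension of `B` forces `Ext_B^i(-, B)` to vanish on modules of finite length for `i ≥ 2`,
so the socle of `B / h`, which is `Ext¹(k, B)`, is a quotient of `Ext¹(B / h, B)`, hence cyclic
(`hasCyclicSocle_of_hasInjectiveDimensionLE`). The Hilbert function of `S / (I + (h))` is therefore
symmetric, and its generating polynomial is `F (1 + ⋯ + t ^ (e - 1))`; hence `F` is palindromic.
-/

/-! ### Regular sequences and `Ext` -/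

section Rees

open CategoryTheory.Abelian RingTheory.Sequence Pointwise

variable {R : Type u} [CommRing R]

theorem ext_smul_eq_zero_of_mem_annihilator {k M : ModuleCat.{u} R} {r : R}
    (hr : r ∈ Module.annihilator R k) {i : ℕ} (x : Ext k M i) : r • x = 0 := by
  have h0 : r • 𝟙 k = 0 := by
    ext y
    exact Module.mem_annihilator.mp hr y
  have h1 : r • x = (Ext.mk₀ (r • 𝟙 k)).comp x (zero_add i) := by
    rw [Ext.mk₀_smul, Ext.smul_comp, Ext.mk₀_id_comp]
  rw [h1, h0, Ext.mk₀_zero, Ext.zero_comp]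

theorem ext_comp_smul_id {X Y : ModuleCat.{u} R} {i : ℕ} (x : Ext X Y i) (b : R) :
    x.comp (Ext.mk₀ (b • 𝟙 Y)) (add_zero i) = b • x := by
  rw [Ext.mk₀_smul, Ext.comp_smul, Ext.comp_mk₀_id]

theorem comp_smulShortComplex_f_eq_zero {k : ModuleCat.{u} R} (M : ModuleCat.{u} R) {r : R}
    (hr : r ∈ Module.annihilator R k) {i : ℕ} (x : Ext k (ModuleCat.smulShortComplex M r).X₁ i) :
    x.comp (Ext.mk₀ (ModuleCat.smulShortComplex M r).f) (add_zero i) = 0 := by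
  have h : x.comp (Ext.mk₀ (r • 𝟙 (ModuleCat.smulShortComplex M r).X₁)) (add_zero i) = 0 := by
    rw [ext_comp_smul_id, ext_smul_eq_zero_of_mem_annihilator hr]
  exact h

/-- If `S.f` acts as zero on `Ext(X, -)` and `Ext^i(X, S.X₂) = 0`, the connecting map
`Ext^i(X, S.X₃) → Ext^{i+1}(X, S.X₁)` is an isomorphism. -/
noncomputable def extClassPostcompEquiv {S : ShortComplex (ModuleCat.{u} R)} (hS : S.ShortExact)
    (X : ModuleCat.{u} R) (i : ℕ)
    (hf : ∀ x : Ext X S.X₁ (i + 1), x.comp (Ext.mk₀ S.f) (add_zero (i + 1)) = 0)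
    (h0 : Subsingleton (Ext X S.X₂ i)) :
    Ext X S.X₃ i ≃ₗ[R] Ext X S.X₁ (i + 1) :=
  LinearEquiv.ofBijective
    { toFun := fun y => y.comp hS.extClass rfl
      map_add' := fun y z => Ext.add_comp y z _ _
      map_smul' := fun c y => Ext.smul_comp y _ _ _ : Ext X S.X₃ i →ₗ[R] Ext X S.X₁ (i + 1) }
    ⟨by
      rw [injective_iff_map_eq_zero]
      intro y hy
      obtain ⟨x, rfl⟩ := Ext.covariant_sequence_exact₃ _ hS y rfl hy
      have : x = 0 := h0.elim _ _
      rw [this, Ext.zero_comp], fun x => Ext.covariant_sequence_exact₁ _ hS x (hf x) rfl⟩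

/-- The connecting isomorphism `Ext^i(k, M / rM) ≃ Ext^{i+1}(k, M)` for an `M`-regular `r` killing
`k`, when `Ext^i(k, M) = 0`. -/
noncomputable def extQuotSMulTopEquiv {k M : ModuleCat.{u} R} {r : R} (hreg : IsSMulRegular M r)
    (hr : r ∈ Module.annihilator R k) (i : ℕ) (h0 : Subsingleton (Ext k M i)) :
    Ext k (ModuleCat.of R (QuotSMulTop r M)) i ≃ₗ[R] Ext k M (i + 1) :=
  extClassPostcompEquiv hreg.smulShortComplex_shortExact k i
    (fun x => comp_smulShortComplex_f_eq_zero M hr x) h0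

theorem subsingleton_ext_zero_of_isSMulRegular {k M : ModuleCat.{u} R} {r : R}
    (hreg : IsSMulRegular M r) (hr : r ∈ Module.annihilator R k) :
    Subsingleton (Ext k M 0) := by
  have : Subsingleton (k ⟶ M) := by
    refine subsingleton_of_forall_eq 0 fun f => ?_
    ext x
    have h : r • f.hom x = r • (0 : M) := by
      rw [← map_smul, Module.mem_annihilator.mp hr, map_zero, smul_zero]
    exact hreg h
  exact Ext.addEquiv₀.toEquiv.subsingleton

/-- The `Ext`-characterization of depth, one half. -/
theorem subsingleton_ext_of_isWeaklyRegular (k : ModuleCat.{u} R) (rs : List R)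
    (hk : ∀ r ∈ rs, r ∈ Module.annihilator R k) (M : ModuleCat.{u} R)
    (h : IsWeaklyRegular M rs) (i : ℕ) (hi : i < rs.length) : Subsingleton (Ext k M i) := by
  induction rs generalizing M i with
  | nil => simp at hi
  | cons r rs ih =>
    rw [isWeaklyRegular_cons_iff] at h
    have hr := hk r (by simp)
    induction i with
    | zero => exact subsingleton_ext_zero_of_isSMulRegular h.1 hr
    | succ i ihi =>
      have hi' : i < rs.length := by simpa using hi
      have h3 := ih (fun r hr => hk r (by simp [hr])) (ModuleCat.of R (QuotSMulTop r M)) h.2 i hi'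
      have h2 : Subsingleton (Ext k M i) := ihi (by lia)
      exact (extQuotSMulTopEquiv h.1 hr i h2).toEquiv.symm.subsingleton

/-- Rees' theorem: `Hom(k, M / (r₁, …, rₘ) M)` depends only on `m`, as it is `Ext^m(k, M)`. -/
theorem nonempty_linearMap_equiv_ext (k : ModuleCat.{u} R) (rs : List R)
    (hk : ∀ r ∈ rs, r ∈ Module.annihilator R k) (M : ModuleCat.{u} R)
    (h : IsWeaklyRegular M rs) :
    Nonempty ((k →ₗ[R] (M ⧸ (Ideal.ofList rs • ⊤ : Submodule R M))) ≃ₗ[R] Ext k M rs.length) := by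
  induction rs generalizing M with
  | nil =>
    let e : (M ⧸ (Ideal.ofList ([] : List R) • ⊤ : Submodule R M)) ≃ₗ[R] M :=
      Submodule.quotEquivOfEqBot _ (by rw [Ideal.ofList_nil, Submodule.bot_smul])
    exact ⟨(LinearEquiv.congrRight e).trans
      ((ModuleCat.homLinearEquiv (S := R)).symm.trans (Ext.linearEquiv₀ (R := R)).symm)⟩
  | cons r rs ih =>
    rw [isWeaklyRegular_cons_iff] at h
    have hr := hk r (by simp)
    obtain ⟨e⟩ := ih (fun r hr => hk r (by simp [hr])) (ModuleCat.of R (QuotSMulTop r M)) h.2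
    have h0 : Subsingleton (Ext k M rs.length) :=
      subsingleton_ext_of_isWeaklyRegular k (r :: rs) hk M
        ((isWeaklyRegular_cons_iff M r rs).mpr h) _ (by simp)
    exact ⟨((LinearEquiv.congrRight
      (Submodule.quotOfListConsSMulTopEquivQuotSMulTopInner M r rs)).trans e).trans
      (extQuotSMulTopEquiv h.1 hr _ h0)⟩

end Rees

/-! ### Socles of complete intersections -/

section Socle

open RingTheory.Sequence Pointwise

/-- The socle `(L : m) / L` of `R / L` is at most one-dimensional: any element of it is a multiple
of any nonzero one. -/
def HasCyclicSocle {R : Type*} [CommRing R] (m L : Ideal R) : Prop :=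
  ∀ y z : R, (∀ a ∈ m, a * y ∈ L) → (∀ a ∈ m, a * z ∈ L) → z ∉ L → ∃ c : R, y - c * z ∈ L

/-- The map `R / m → R / L`, `1 ↦ y`, defined by an element `y` of `(L : m)`. -/
noncomputable def socleHom {R : Type*} [CommRing R] (m L : Ideal R) (y : R)
    (hy : ∀ a ∈ m, a * y ∈ L) : (R ⧸ m) →ₗ[R] (R ⧸ L) :=
  Submodule.liftQ m (LinearMap.toSpanSingleton R (R ⧸ L) (Ideal.Quotient.mk L y)) (by
    intro a ha
    rw [LinearMap.mem_ker, LinearMap.toSpanSingleton_apply]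
    exact Ideal.Quotient.eq_zero_iff_mem.mpr (hy a ha))

theorem socleHom_one {R : Type*} [CommRing R] (m L : Ideal R) (y : R)
    (hy : ∀ a ∈ m, a * y ∈ L) : socleHom m L y hy 1 = Ideal.Quotient.mk L y := by
  change LinearMap.toSpanSingleton R (R ⧸ L) (Ideal.Quotient.mk L y) 1 = _
  simp

/-- `HasCyclicSocle` can be checked in any module into which `Hom(R / m, R / L)` embeds. -/
theorem HasCyclicSocle.of_injective {R : Type*} [CommRing R] {m L : Ideal R} {E : Type*}
    [AddCommGroup E] [Module R E] (e : ((R ⧸ m) →ₗ[R] (R ⧸ L)) →ₗ[R] E)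
    (he : Function.Injective e) (hE : ∀ x z : E, z ≠ 0 → ∃ c : R, x = c • z) :
    HasCyclicSocle m L := by
  intro y z hy hz hzL
  have hne : e (socleHom m L z hz) ≠ 0 := by
    intro h
    rw [map_eq_zero_iff e he] at h
    have := socleHom_one m L z hz
    rw [h, LinearMap.zero_apply] at this
    exact hzL (Ideal.Quotient.eq_zero_iff_mem.mp this.symm)
  obtain ⟨c, hc⟩ := hE (e (socleHom m L y hy)) _ hne
  rw [← map_smul] at hc
  have h1 := congrArg (fun φ => φ 1) (he hc)
  simp only [LinearMap.smul_apply, socleHom_one] at h1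
  refine ⟨c, Ideal.Quotient.eq_zero_iff_mem.mp ?_⟩
  rw [map_sub, map_mul, h1, sub_eq_zero]
  rfl

theorem mem_annihilator_quotient {R : Type*} [CommRing R] {m : Ideal R} {r : R} (hr : r ∈ m) :
    r ∈ Module.annihilator R (R ⧸ m) := by
  rw [Ideal.annihilator_quotient]
  exact hr

theorem isSMulRegular_quotient_iff {R : Type*} [CommRing R] (L : Ideal R) (g : R) :
    IsSMulRegular (R ⧸ L) g ↔ ∀ y, g * y ∈ L → y ∈ L :=
  isSMulRegular_quotient_iff_mem_of_smul_mem L g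

theorem isWeaklyRegular_concat_iff {R : Type*} [CommRing R] (rs : List R) (g : R) :
    IsWeaklyRegular R (rs ++ [g]) ↔
      IsWeaklyRegular R rs ∧ ∀ y, g * y ∈ Ideal.ofList rs → y ∈ Ideal.ofList rs := by
  rw [isWeaklyRegular_append_iff, isWeaklyRegular_singleton_iff, smul_eq_mul, Ideal.mul_top,
    isSMulRegular_quotient_iff]

/-- If `r₁, …, rₘ` and `s₁, …, sₘ` are regular sequences of the same length in a maximal ideal
generated by the latter, then `R / (r₁, …, rₘ)` has a simple socle. -/
theorem hasCyclicSocle_of_isWeaklyRegular {R : Type u} [CommRing R] {m : Ideal R}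
    [hm : m.IsMaximal] {rs xs : List R} (hrs : IsWeaklyRegular R rs) (hxs : IsWeaklyRegular R xs)
    (hrm : ∀ r ∈ rs, r ∈ m) (hxm : Ideal.ofList xs = m) (hlen : rs.length = xs.length) :
    HasCyclicSocle m (Ideal.ofList rs) := by
  obtain ⟨e⟩ := nonempty_linearMap_equiv_ext (ModuleCat.of R (R ⧸ m)) rs
    (fun r hr => mem_annihilator_quotient (hrm r hr)) (ModuleCat.of R R) hrs
  have hxm' : ∀ r ∈ xs, r ∈ m := fun r hr => hxm ▸ Ideal.subset_span hr
  obtain ⟨e'⟩ := nonempty_linearMap_equiv_ext (ModuleCat.of R (R ⧸ m)) xs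
    (fun r hr => mem_annihilator_quotient (hxm' r hr)) (ModuleCat.of R R) hxs
  have h1 : (Ideal.ofList rs • ⊤ : Submodule R R) = Ideal.ofList rs := by
    rw [smul_eq_mul, Ideal.mul_top]
  have h2 : (Ideal.ofList xs • ⊤ : Submodule R R) = m := by
    rw [smul_eq_mul, Ideal.mul_top, hxm]
  rw [← hlen] at e'
  let e₁ : ((R ⧸ m) →ₗ[R] (R ⧸ Ideal.ofList rs)) ≃ₗ[R] ((R ⧸ m) →ₗ[R] (R ⧸ m)) :=
    (LinearEquiv.congrRight (Submodule.quotEquivOfEq _ _ h1.symm)).trans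
      (e.trans (e'.symm.trans (LinearEquiv.congrRight (Submodule.quotEquivOfEq _ _ h2))))
  refine HasCyclicSocle.of_injective e₁.toLinearMap e₁.injective fun x z hz => ?_
  have hz1 : z 1 ≠ 0 := by
    intro h
    apply hz
    refine LinearMap.ext fun a => ?_
    obtain ⟨a, rfl⟩ := Ideal.Quotient.mk_surjective a
    have : Ideal.Quotient.mk m a = a • (1 : R ⧸ m) := by
      rw [Algebra.smul_def, mul_one]; rfl
    rw [this, map_smul, h, smul_zero, LinearMap.zero_apply]
  let _ := Ideal.Quotient.field m
  obtain ⟨c, hc⟩ := Ideal.Quotient.mk_surjective (x 1 / z 1)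
  refine ⟨c, LinearMap.ext fun a => ?_⟩
  obtain ⟨a, rfl⟩ := Ideal.Quotient.mk_surjective a
  have h3 : Ideal.Quotient.mk m a = a • (1 : R ⧸ m) := by
    rw [Algebra.smul_def, mul_one]; rfl
  have h4 : x 1 = c • z 1 := by
    rw [Algebra.smul_def]
    change x 1 = Ideal.Quotient.mk m c * z 1
    rw [hc, div_mul_cancel₀ _ hz1]
  rw [h3, map_smul, map_smul, LinearMap.smul_apply, h4]

/-- An ideal generated by a regular sequence in `m` that is shorter than another one in `m` has no
socle with respect to `m`. -/
theorem mem_of_forall_mul_mem_of_length_lt {R : Type u} [CommRing R] {m : Ideal R}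
    {rs xs : List R} (hrs : IsWeaklyRegular R rs) (hxs : IsWeaklyRegular R xs)
    (hrm : ∀ r ∈ rs, r ∈ m) (hxm : ∀ r ∈ xs, r ∈ m) (hlen : rs.length < xs.length) {y : R}
    (hy : ∀ a ∈ m, a * y ∈ Ideal.ofList rs) : y ∈ Ideal.ofList rs := by
  obtain ⟨e⟩ := nonempty_linearMap_equiv_ext (ModuleCat.of R (R ⧸ m)) rs
    (fun r hr => mem_annihilator_quotient (hrm r hr)) (ModuleCat.of R R) hrs
  have h0 := subsingleton_ext_of_isWeaklyRegular (ModuleCat.of R (R ⧸ m)) xs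
    (fun r hr => mem_annihilator_quotient (hxm r hr)) (ModuleCat.of R R) hxs _ hlen
  have h1 : (Ideal.ofList rs • ⊤ : Submodule R R) = Ideal.ofList rs := by
    rw [smul_eq_mul, Ideal.mul_top]
  have := ((LinearEquiv.congrRight (Submodule.quotEquivOfEq _ _ h1.symm)).trans
    e : ((R ⧸ m) →ₗ[R] (R ⧸ Ideal.ofList rs)) ≃ₗ[R] _).toEquiv.subsingleton
  have h2 := socleHom_one m (Ideal.ofList rs) y hy
  rw [Subsingleton.elim (socleHom m (Ideal.ofList rs) y hy) 0, LinearMap.zero_apply] at h2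
  exact Ideal.Quotient.eq_zero_iff_mem.mp h2.symm

end Socle

section Variables

open RingTheory.Sequence MvPolynomial

variable {K : Type*} [Field K] {m : ℕ}

variable (K m) in
theorem ofList_ofFn_X :
    Ideal.ofList (List.ofFn fun i : Fin m => (X i : MvPolynomial (Fin m) K)) =
      maxIdealOfVars (Fin m) K := by
  unfold Ideal.ofList maxIdealOfVars
  congr 1
  ext p
  simp [List.mem_ofFn]

variable (K m) in
theorem isWeaklyRegular_ofFn_X :
    IsWeaklyRegular (MvPolynomial (Fin m) K)
      (List.ofFn fun i : Fin m => (X i : MvPolynomial (Fin m) K)) := by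
  rw [isWeaklyRegular_iff_Fin]
  intro i
  have hi : (i : ℕ) < m := by simpa using i.2
  have hL : Ideal.ofList ((List.ofFn fun i : Fin m => (X i : MvPolynomial (Fin m) K)).take i) =
      Ideal.span (X '' {j : Fin m | (j : ℕ) < i}) := by
    unfold Ideal.ofList
    congr 1
    ext p
    simp only [Set.mem_ofPred_eq, List.mem_take_iff_getElem, List.getElem_ofFn, Set.mem_image,
      List.length_ofFn]
    constructor
    · rintro ⟨j, hj, rfl⟩
      exact ⟨⟨j, by lia⟩, by simpa using (by lia : j < (i : ℕ)), rfl⟩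
    · rintro ⟨j, hj, rfl⟩
      exact ⟨j, by have := j.2; lia, rfl⟩
  rw [smul_eq_mul, Ideal.mul_top, hL, isSMulRegular_quotient_iff]
  intro p hp
  simp only [Fin.getElem_fin, List.getElem_ofFn] at hp
  rw [mem_ideal_span_X_image] at hp ⊢
  intro d hd
  obtain ⟨j, hj, hj'⟩ := hp (Finsupp.single ⟨i, hi⟩ 1 + d) (by
    rw [mem_support_iff, coeff_X_mul]
    exact mem_support_iff.mp hd)
  refine ⟨j, hj, ?_⟩
  have hne : (⟨i, hi⟩ : Fin m) ≠ j := by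
    rintro rfl
    simp at hj
  simpa [Finsupp.single_apply, hne] using hj'

instance maxIdealOfVars_isMaximal {σ : Type*} : (maxIdealOfVars σ K).IsMaximal := by
  have h : maxIdealOfVars σ K = RingHom.ker (constantCoeff (σ := σ) (R := K)) := by
    ext p
    have := mem_ideal_span_X_image (σ := σ) (R := K) (x := p) (s := Set.univ)
    rw [Set.image_univ] at this
    rw [maxIdealOfVars, this, RingHom.mem_ker, constantCoeff_eq]
    constructor
    · intro h
      by_contra h0
      obtain ⟨i, -, hi⟩ := h 0 (mem_support_iff.mpr h0)
      simp at hi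
    · intro h d hd
      have : d ≠ 0 := by
        rintro rfl
        exact mem_support_iff.mp hd h
      obtain ⟨i, hi⟩ := Finsupp.ne_iff.mp this
      exact ⟨i, trivial, by simpa using hi⟩
  rw [h]
  exact RingHom.ker_isMaximal_of_surjective _ fun a => ⟨C a, constantCoeff_C _ a⟩

end Variables

/-! ### Finite self-injective dimension in dimension one -/

section FiniteInjectiveDimension

open CategoryTheory.Abelian IsLocalRing Pointwise

theorem moduleCat_shortExact {R : Type u} [CommRing R] {M N P : Type u} [AddCommGroup M]
    [AddCommGroup N] [AddCommGroup P] [Module R M] [Module R N] [Module R P] (f : M →ₗ[R] N)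
    (g : N →ₗ[R] P) (hf : Function.Injective f) (hg : Function.Surjective g)
    (hfg : Function.Exact f g) :
    (ModuleCat.shortComplexOfCompEqZero f g hfg.linearMap_comp_eq_zero).ShortExact :=
  ModuleCat.shortComplex_shortExact _ hfg hf hg

theorem subsingleton_ext_X₂ {R : Type u} [CommRing R] {S : ShortComplex (ModuleCat.{u} R)}
    (hS : S.ShortExact) (Y : ModuleCat.{u} R) (i : ℕ) (h1 : Subsingleton (Ext S.X₁ Y i))
    (h3 : Subsingleton (Ext S.X₃ Y i)) : Subsingleton (Ext S.X₂ Y i) := by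
  refine subsingleton_of_forall_eq 0 fun x => ?_
  obtain ⟨y, rfl⟩ := Ext.contravariant_sequence_exact₂ hS Y x (h1.elim _ _)
  rw [h3.elim y 0, Ext.comp_zero]

section Local

variable {B : Type u} [CommRing B] [IsLocalRing B]

/-- Dévissage: if `Ext^i(k, Y)` vanishes for the residue field `k`, so does `Ext^i(M, Y)` for all
modules `M` of finite length. -/
theorem subsingleton_ext_of_isFiniteLength (Y : ModuleCat.{u} B) (i : ℕ)
    (hk : Subsingleton (Ext (ModuleCat.of B (B ⧸ maximalIdeal B)) Y i))
    (M : Type u) [AddCommGroup M] [Module B M] (hM : IsFiniteLength B M) :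
    Subsingleton (Ext (ModuleCat.of B M) Y i) := by
  induction hM with
  | @of_subsingleton M _ _ _ =>
    have : Limits.IsZero (ModuleCat.of B M) := ModuleCat.isZero_of_subsingleton _
    refine subsingleton_of_forall_eq 0 fun x => ?_
    rw [← Ext.mk₀_id_comp x, this.eq_of_src (𝟙 _) 0, Ext.mk₀_zero, Ext.zero_comp]
  | @of_simple_quotient M _ _ N hs _ ih =>
    obtain ⟨I, hI, ⟨e⟩⟩ := isSimpleModule_iff_quot_maximal.mp hs
    obtain rfl := eq_maximalIdeal hI
    refine subsingleton_ext_X₂ (moduleCat_shortExact N.subtype (e.toLinearMap ∘ₗ N.mkQ)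
      N.subtype_injective (e.surjective.comp N.mkQ_surjective) ?_) Y i ih hk
    intro x
    simp

/-- If `B` has finite injective dimension over itself and `h` is a nonzerodivisor such that `B / h`
has finite length and nonzero socle, then `Ext^i(-, B)` vanishes on finite length modules
for all `i ≥ 2`. -/
theorem subsingleton_ext_of_two_le {r : ℕ}
    (hB : HasInjectiveDimensionLE (ModuleCat.of B B) r) {h : B} (hreg : IsSMulRegular B h)
    (hC : IsFiniteLength B (QuotSMulTop h B))
    (φ : (B ⧸ maximalIdeal B) →ₗ[B] QuotSMulTop h B) (hφ : Function.Injective φ) (i : ℕ)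
    (hi : 2 ≤ i) (M : Type u) [AddCommGroup M] [Module B M] (hM : IsFiniteLength B M) :
    Subsingleton (Ext (ModuleCat.of B M) (ModuleCat.of B B) i) := by
  suffices H : ∀ j i : ℕ, 2 ≤ i → r + 1 ≤ i + j → ∀ (M : Type u) [AddCommGroup M] [Module B M],
      IsFiniteLength B M → Subsingleton (Ext (ModuleCat.of B M) (ModuleCat.of B B) i) from
    H (r + 1) i hi (by lia) M hM
  intro j
  induction j with
  | zero =>
    intro i _ hij M _ _ _
    exact HasInjectiveDimensionLT.subsingleton (ModuleCat.of B B) (r + 1) i hij _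
  | succ j ih =>
    intro i hi hij M _ _ hM
    refine subsingleton_ext_of_isFiniteLength _ i ?_ M hM
    -- the residue field embeds in `B / h`, with a quotient of finite length
    have hS := moduleCat_shortExact φ (LinearMap.range φ).mkQ hφ
      (LinearMap.range φ).mkQ_surjective (LinearMap.exact_map_mkQ_range φ)
    have hQ := ih (i + 1) (by lia) (by lia) (QuotSMulTop h B ⧸ LinearMap.range φ)
      (hC.of_surjective (LinearMap.range φ).mkQ_surjective)
    refine subsingleton_of_forall_eq 0 fun x => ?_
    obtain ⟨y, rfl⟩ := Ext.contravariant_sequence_exact₁ hS _ x (add_comm 1 i) (hQ.elim _ _)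
    -- `Ext^i(B / h, B) = 0`, from `0 → B → B → B / h → 0`
    have hy : y = 0 := by
      obtain ⟨z, hz⟩ := Ext.contravariant_sequence_exact₃
        (IsSMulRegular.smulShortComplex_shortExact (M := ModuleCat.of B B) hreg) _ y (by
          have : Projective (ModuleCat.of B B) := inferInstance
          obtain ⟨i, rfl⟩ := Nat.exists_eq_add_of_le' (show 1 ≤ i by lia)
          exact Ext.eq_zero_of_projective (P := ModuleCat.of B B) _) (n₀ := i - 1) (by lia)
      obtain ⟨i, rfl⟩ := Nat.exists_eq_add_of_le' hi
      have hz0 : z = 0 := Ext.eq_zero_of_projective (P := ModuleCat.of B B) (n := i) z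
      rw [← hz, hz0, Ext.comp_zero]
      rfl
    rw [hy, Ext.comp_zero]

/-- A Noetherian local ring `B` of finite self-injective dimension with a nonzerodivisor `h` such
that `B / h` is Artinian: the socle of `B / h` is isomorphic to `Ext¹(k, B)`, which is a quotient of
`Ext¹(B / h, B)`, hence of `Hom(B, B)`, and so is cyclic. -/
theorem hasCyclicSocle_of_hasInjectiveDimensionLE [IsNoetherianRing B] {r : ℕ}
    (hB : HasInjectiveDimensionLE (ModuleCat.of B B) r) {h : B} (hreg : IsSMulRegular B h)
    (hm : h ∈ maximalIdeal B) {N : ℕ} (hN : maximalIdeal B ^ N ≤ Ideal.span {h}) :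
    HasCyclicSocle (maximalIdeal B) (Ideal.span {h}) := by
  by_cases hz : ∃ z, z ∉ Ideal.span {h} ∧ ∀ a ∈ maximalIdeal B, a * z ∈ Ideal.span {h}
  swap
  · intro y z _ hz1 hz2
    exact absurd ⟨z, hz2, hz1⟩ hz
  obtain ⟨z, hz, hz'⟩ := hz
  have hspan : (h • ⊤ : Submodule B B) = Ideal.span {h} := by
    rw [← Submodule.ideal_span_singleton_smul, smul_eq_mul, Ideal.mul_top]
  let eC : (B ⧸ Ideal.span {h}) ≃ₗ[B] QuotSMulTop h B := Submodule.quotEquivOfEq _ _ hspan.symm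
  -- `B / h` has finite length
  have hArt : IsFiniteLength B (B ⧸ Ideal.span {h}) := by
    have hne : Ideal.span {h} ≠ ⊤ := fun h => hz (h ▸ trivial)
    have := Ideal.Quotient.nontrivial_iff.mpr hne
    have hloc : IsLocalRing (B ⧸ Ideal.span {h}) :=
      IsLocalRing.of_surjective' (Ideal.Quotient.mk _) Ideal.Quotient.mk_surjective
    have : IsArtinianRing (B ⧸ Ideal.span {h}) := by
      rw [isArtinianRing_iff_isNilpotent_maximalIdeal]
      refine ⟨N, ?_⟩
      have hmap : maximalIdeal (B ⧸ Ideal.span {h}) =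
          (maximalIdeal B).map (Ideal.Quotient.mk (Ideal.span {h})) := by
        exact (map_maximalIdeal_of_surjective _ Ideal.Quotient.mk_surjective).symm
      rw [hmap, ← Ideal.map_pow, Ideal.zero_eq_bot, Ideal.map_eq_bot_iff_le_ker, Ideal.mk_ker]
      exact hN
    rw [isFiniteLength_iff_isNoetherian_isArtinian]
    exact ⟨inferInstance, isArtinian_of_surjective_algebraMap
      (Ideal.Quotient.mk_surjective (I := Ideal.span {h}))⟩
  have hC : IsFiniteLength B (QuotSMulTop h B) := hArt.of_surjective eC.surjective
  let φ : (B ⧸ maximalIdeal B) →ₗ[B] QuotSMulTop h B :=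
    eC.toLinearMap ∘ₗ socleHom (maximalIdeal B) (Ideal.span {h}) z hz'
  have hφ : Function.Injective φ := by
    refine eC.injective.comp ?_
    rw [injective_iff_map_eq_zero]
    intro a ha
    obtain ⟨a, rfl⟩ := Ideal.Quotient.mk_surjective a
    by_contra hne
    have hu : IsUnit a := by
      by_contra hu
      exact hne (Ideal.Quotient.eq_zero_iff_mem.mpr ((mem_maximalIdeal a).mpr hu))
    have h3 : Ideal.Quotient.mk (maximalIdeal B) a = a • (1 : B ⧸ maximalIdeal B) := by
      rw [Algebra.smul_def, mul_one]; rfl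
    rw [h3, map_smul, hu.smul_eq_zero, socleHom_one] at ha
    exact hz (Ideal.Quotient.eq_zero_iff_mem.mp ha)
  have hk : h ∈ Module.annihilator B (B ⧸ maximalIdeal B) := mem_annihilator_quotient hm
  have h0 : Subsingleton (Ext (ModuleCat.of B (B ⧸ maximalIdeal B)) (ModuleCat.of B B) 0) :=
    subsingleton_ext_zero_of_isSMulRegular hreg hk
  let e : ((B ⧸ maximalIdeal B) →ₗ[B] (B ⧸ Ideal.span {h})) ≃ₗ[B]
      Ext (ModuleCat.of B (B ⧸ maximalIdeal B)) (ModuleCat.of B B) 1 :=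
    (LinearEquiv.congrRight eC).trans
      (((ModuleCat.homLinearEquiv (S := B)).symm.trans (Ext.linearEquiv₀ (R := B)).symm).trans
        (extQuotSMulTopEquiv (k := ModuleCat.of B (B ⧸ maximalIdeal B)) (M := ModuleCat.of B B)
          hreg hk 0 h0))
  refine HasCyclicSocle.of_injective e.toLinearMap e.injective ?_
  -- a generator of `Ext¹(k, B)`
  have hS := moduleCat_shortExact φ (LinearMap.range φ).mkQ hφ
      (LinearMap.range φ).mkQ_surjective (LinearMap.exact_map_mkQ_range φ)
  have hQ := subsingleton_ext_of_two_le hB hreg hC φ hφ 2 le_rfl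
    (QuotSMulTop h B ⧸ LinearMap.range φ)
    (hC.of_surjective (LinearMap.range φ).mkQ_surjective)
  have hS' := IsSMulRegular.smulShortComplex_shortExact (M := ModuleCat.of B B) hreg
  have hgen : ∃ ξ : Ext (ModuleCat.of B (B ⧸ maximalIdeal B)) (ModuleCat.of B B) 1,
      ∀ x : Ext (ModuleCat.of B (B ⧸ maximalIdeal B)) (ModuleCat.of B B) 1,
        ∃ b : B, x = b • ξ := by
    refine ⟨(Ext.mk₀ (ModuleCat.ofHom φ)).comp hS'.extClass (zero_add 1), fun x => ?_⟩
    obtain ⟨y, rfl⟩ := Ext.contravariant_sequence_exact₁ hS _ x (n₁ := 2) rfl (hQ.elim _ _)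
    obtain ⟨t, rfl⟩ := Ext.contravariant_sequence_exact₃ hS' _ y (n₀ := 0)
      (Ext.eq_zero_of_projective (P := ModuleCat.of B B) (n := 0) _) rfl
    obtain ⟨t, rfl⟩ := Ext.addEquiv₀.symm.surjective t
    have ht : ∃ b : B, t = b • 𝟙 (ModuleCat.of B B) := by
      refine ⟨t.hom (1 : B), ?_⟩
      ext
      exact (mul_one _).symm
    obtain ⟨b, rfl⟩ := ht
    refine ⟨b, ?_⟩
    have h1 : hS'.extClass.comp (Ext.mk₀ (b • 𝟙 (ModuleCat.of B B))) (add_zero 1) =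
        b • hS'.extClass :=
      ext_comp_smul_id hS'.extClass b
    change (Ext.mk₀ (ModuleCat.ofHom φ)).comp
      (hS'.extClass.comp (Ext.mk₀ (b • 𝟙 (ModuleCat.of B B))) (add_zero 1)) (zero_add 1) = _
    rw [h1]
    exact Ext.comp_smul _ _ _ b
  obtain ⟨ξ, hξ⟩ := hgen
  intro x w hw
  obtain ⟨a, rfl⟩ := hξ x
  obtain ⟨b, rfl⟩ := hξ w
  have hb : IsUnit b := by
    by_contra hb
    exact hw (ext_smul_eq_zero_of_mem_annihilator
      (mem_annihilator_quotient ((mem_maximalIdeal b).mpr hb)) ξ)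
  obtain ⟨b, rfl⟩ := hb
  exact ⟨a * ↑b⁻¹, by rw [smul_smul, mul_assoc, Units.inv_mul, mul_one]⟩

end Local

/-- The socle of `A / h` with respect to a maximal ideal `P` is seen after localizing at `P`. -/
theorem hasCyclicSocle_of_localization {A : Type u} [CommRing A] [IsNoetherianRing A] (P : Ideal A)
    [hP : P.IsMaximal] {r : ℕ}
    (hB : HasInjectiveDimensionLE
      (ModuleCat.of (Localization.AtPrime P) (Localization.AtPrime P)) r)
    {h : A} (hreg : ∀ a, h * a = 0 → a = 0) (hm : h ∈ P) {N : ℕ} (hN : P ^ N ≤ Ideal.span {h}) :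
    HasCyclicSocle P (Ideal.span {h}) := by
  let B := Localization.AtPrime P
  have hmax := Localization.AtPrime.map_eq_maximalIdeal (I := P)
  have hspan : Ideal.map (algebraMap A B) (Ideal.span {h}) = Ideal.span {algebraMap A B h} := by
    rw [Ideal.map_span, Set.image_singleton]
  have hB' : HasCyclicSocle (maximalIdeal B) (Ideal.span {algebraMap A B h}) := by
    refine hasCyclicSocle_of_hasInjectiveDimensionLE hB ?_ ?_ (N := N) ?_
    · rw [isSMulRegular_iff_right_eq_zero_of_smul]
      intro b hb
      obtain ⟨⟨a, s⟩, rfl⟩ := IsLocalization.mk'_surjective P.primeCompl b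
      rw [smul_eq_mul, IsLocalization.mul_mk'_eq_mk'_of_mul,
        IsLocalization.mk'_eq_zero_iff] at hb
      obtain ⟨t, ht⟩ := hb
      exact (IsLocalization.mk'_eq_zero_iff _ _).mpr ⟨t, hreg _ (by rw [← ht]; ring)⟩
    · rw [← hmax]
      exact Ideal.mem_map_of_mem _ hm
    · rw [← hmax, ← Ideal.map_pow, ← hspan]
      exact Ideal.map_mono hN
  -- elements outside `P` act invertibly on the socle of `A / h`
  have hunit : ∀ s ∉ P, ∃ t, 1 - t * s ∈ P := by
    intro s hs
    obtain ⟨t, p, hp, htp⟩ := hP.exists_inv hs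
    exact ⟨t, by rw [← htp]; simpa using hp⟩
  have hcontr : ∀ y, (∀ a ∈ P, a * y ∈ Ideal.span {h}) →
      algebraMap A B y ∈ Ideal.span {algebraMap A B h} → y ∈ Ideal.span {h} := by
    intro y hy hyB
    rw [← hspan, IsLocalization.algebraMap_mem_map_algebraMap_iff P.primeCompl] at hyB
    obtain ⟨s, hs, hsy⟩ := hyB
    obtain ⟨t, ht⟩ := hunit s hs
    have h1 := Ideal.add_mem _ (Ideal.mul_mem_left _ t hsy) (hy _ ht)
    convert h1 using 1
    ring
  have hloc : ∀ y, (∀ a ∈ P, a * y ∈ Ideal.span {h}) →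
      ∀ a ∈ maximalIdeal B, a * algebraMap A B y ∈ Ideal.span {algebraMap A B h} := by
    intro y hy a ha
    rw [← hmax] at ha
    have hle : P.map (algebraMap A B) ≤
        (Ideal.span {algebraMap A B h}).colon {algebraMap A B y} := by
      rw [Ideal.map_le_iff_le_comap]
      intro p hp
      rw [Ideal.mem_comap, Submodule.mem_colon_singleton, smul_eq_mul, ← map_mul, ← hspan]
      exact Ideal.mem_map_of_mem _ (hy p hp)
    exact Submodule.mem_colon_singleton.mp (hle ha)
  intro y z hy hz hz0
  obtain ⟨b, hb⟩ := hB' _ _ (hloc y hy) (hloc z hz) fun h => hz0 (hcontr z hz h)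
  obtain ⟨⟨a, s⟩, rfl⟩ := IsLocalization.mk'_surjective P.primeCompl b
  obtain ⟨t, ht⟩ := hunit s s.2
  have h1 : (s : A) * y - a * z ∈ Ideal.span {h} := by
    refine hcontr _ (fun p hp => ?_) ?_
    · have := Ideal.sub_mem _ (Ideal.mul_mem_left _ (s : A) (hy p hp))
        (Ideal.mul_mem_left _ a (hz p hp))
      convert this using 1
      ring
    · have := Ideal.mul_mem_left _ (algebraMap A B s) hb
      convert this using 1
      rw [mul_sub, ← mul_assoc, IsLocalization.mk'_spec', map_sub, map_mul, map_mul]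
  refine ⟨t * a, ?_⟩
  have h2 := Ideal.add_mem _ (Ideal.mul_mem_left _ t h1) (hy _ ht)
  convert h2 using 1
  ring

/-- If `R / I` is Gorenstein, `h` is a nonzerodivisor on it, and `m` is a maximal ideal with
`m ^ N ⊆ I + (h)`, then the socle of `R / (I + (h))` is at most one-dimensional. -/
theorem IsGorensteinRing.hasCyclicSocle {R : Type u} [CommRing R] {I m : Ideal R}
    [hm : m.IsMaximal] (hG : IsGorensteinRing (R ⧸ I)) (hI : I ≤ m) {h : R}
    (hreg : ∀ y, h * y ∈ I → y ∈ I) (hh : h ∈ m) {N : ℕ} (hN : m ^ N ≤ I ⊔ Ideal.span {h}) :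
    HasCyclicSocle m (I ⊔ Ideal.span {h}) := by
  have := hG.1
  have hmem : ∀ y, Ideal.Quotient.mk I y ∈ Ideal.span {Ideal.Quotient.mk I h} ↔
      y ∈ I ⊔ Ideal.span {h} := by
    intro y
    rw [← Set.image_singleton, ← Ideal.map_span, ← Ideal.mem_comap,
      Ideal.comap_map_of_surjective _ Ideal.Quotient.mk_surjective, ← RingHom.ker_eq_comap_bot,
      Ideal.mk_ker, sup_comm]
  have hPmax : (m.map (Ideal.Quotient.mk I)).IsMaximal := by
    refine (Ideal.map_eq_top_or_isMaximal_of_surjective _ Ideal.Quotient.mk_surjective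
      hm).resolve_left fun htop => hm.ne_top ?_
    have := congrArg (Ideal.comap (Ideal.Quotient.mk I)) htop
    rwa [Ideal.comap_map_of_surjective _ Ideal.Quotient.mk_surjective, Ideal.comap_top,
      ← RingHom.ker_eq_comap_bot, Ideal.mk_ker, sup_eq_left.mpr hI] at this
  obtain ⟨r, hr⟩ := hG.2 (m.map (Ideal.Quotient.mk I))
  have hsoc := hasCyclicSocle_of_localization (m.map (Ideal.Quotient.mk I)) hr
    (h := Ideal.Quotient.mk I h) (by
      intro a ha
      obtain ⟨a, rfl⟩ := Ideal.Quotient.mk_surjective a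
      rw [← map_mul, Ideal.Quotient.eq_zero_iff_mem] at ha
      exact Ideal.Quotient.eq_zero_iff_mem.mpr (hreg a ha))
    (Ideal.mem_map_of_mem _ hh) (N := N) (by
      rw [← Ideal.map_pow, Ideal.map_le_iff_le_comap]
      exact fun y hy => (hmem y).mpr (hN hy))
  intro y z hy hz hz0
  have key : ∀ y, (∀ a ∈ m, a * y ∈ I ⊔ Ideal.span {h}) → ∀ a ∈ m.map (Ideal.Quotient.mk I),
      a * Ideal.Quotient.mk I y ∈ Ideal.span {Ideal.Quotient.mk I h} := by
    intro y hy a ha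
    obtain ⟨a', ha', rfl⟩ :=
      (Ideal.mem_map_iff_of_surjective _ Ideal.Quotient.mk_surjective).mp ha
    rw [← map_mul, hmem]
    exact hy a' ha'
  obtain ⟨c, hc⟩ := hsoc _ _ (key y hy) (key z hz) ((hmem z).not.mpr hz0)
  obtain ⟨c, rfl⟩ := Ideal.Quotient.mk_surjective c
  rw [← map_mul, ← map_sub, hmem] at hc
  exact ⟨c, hc⟩

end FiniteInjectiveDimension

/-! ### Hilbert functions of homogeneous ideals -/

section HilbertFunction

open MvPolynomial RingTheory.Sequence

attribute [local instance] MvPolynomial.gradedAlgebra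

variable {σ : Type*} {K : Type*} [Field K]

/-- The Hilbert function `p ↦ dim_K (S / L)_p`. -/
noncomputable def hilbertFn (L : Ideal (MvPolynomial σ K)) (p : ℕ) : ℕ :=
  Module.finrank K (gradedPiece L p)

theorem coeff_quotientHilbertSeries (L : Ideal (MvPolynomial σ K)) (p : ℕ) :
    PowerSeries.coeff p (quotientHilbertSeries L) = hilbertFn L p :=
  PowerSeries.coeff_mk _ _

theorem coe_decompose_eq (q : MvPolynomial σ K) (i : ℕ) :
    (DirectSum.decompose (homogeneousSubmodule σ K) q i : MvPolynomial σ K) =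
      homogeneousComponent i q :=
  decomposition.decompose'_apply q i

theorem homogeneousComponent_mul_add {g : MvPolynomial σ K} {d : ℕ} (hg : g.IsHomogeneous d)
    (b : MvPolynomial σ K) (p : ℕ) :
    homogeneousComponent (d + p) (g * b) = g * homogeneousComponent p b := by
  have h := DirectSum.coe_decompose_mul_add_of_left_mem (homogeneousSubmodule σ K) (i := d) (j := p)
    (a := g) (b := b) hg
  rwa [coe_decompose_eq, coe_decompose_eq] at h

theorem homogeneousComponent_mul_of_lt {g : MvPolynomial σ K} {d : ℕ} (hg : g.IsHomogeneous d)
    (b : MvPolynomial σ K) {p : ℕ} (hp : p < d) : homogeneousComponent p (g * b) = 0 := by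
  have h := DirectSum.coe_decompose_mul_of_left_mem_of_not_le (homogeneousSubmodule σ K) (i := d)
    (n := p) (a := g) (b := b) hg (by lia)
  rwa [coe_decompose_eq] at h

theorem isHomogeneous_ideal_iff {L : Ideal (MvPolynomial σ K)} :
    L.IsHomogeneous (homogeneousSubmodule σ K) ↔
      ∀ y ∈ L, ∀ i, homogeneousComponent i y ∈ L := by
  refine ⟨fun h y hy i => homogeneousComponent_mem_of_mem h hy i, fun h i y hy => ?_⟩
  rw [coe_decompose_eq]
  exact h y hy i

theorem isHomogeneous_span_singleton {g : MvPolynomial σ K} {d : ℕ} (hg : g.IsHomogeneous d) :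
    (Ideal.span {g}).IsHomogeneous (homogeneousSubmodule σ K) :=
  Ideal.homogeneous_span _ _ fun x hx => ⟨d, by rw [Set.mem_singleton_iff.mp hx]; exact hg⟩

theorem mem_sup_span_singleton_iff {L : Ideal (MvPolynomial σ K)}
    (hL : L.IsHomogeneous (homogeneousSubmodule σ K)) {g : MvPolynomial σ K} {d : ℕ}
    (hg : g.IsHomogeneous d) {y : MvPolynomial σ K} {p : ℕ} (hy : y.IsHomogeneous (d + p)) :
    y ∈ L ⊔ Ideal.span {g} ↔ ∃ b : MvPolynomial σ K, b.IsHomogeneous p ∧ y - g * b ∈ L := by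
  constructor
  · intro h
    obtain ⟨l, hl, z, hz, rfl⟩ := Submodule.mem_sup.mp h
    obtain ⟨b, rfl⟩ := Ideal.mem_span_singleton'.mp hz
    refine ⟨homogeneousComponent p b, homogeneousComponent_isHomogeneous _ _, ?_⟩
    rw [← homogeneousComponent_mul_add hg, ← homogeneousComponent_eq_self hy, ← map_sub]
    refine homogeneousComponent_mem_of_mem hL ?_ _
    rwa [mul_comm g b, add_sub_cancel_right]
  · rintro ⟨b, -, h⟩
    rw [← sub_add_cancel y (g * b)]
    exact Ideal.add_mem _ (Ideal.mem_sup_left h)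
      (Ideal.mem_sup_right (Ideal.mul_mem_right _ _ (Ideal.mem_span_singleton_self g)))

theorem mem_sup_span_singleton_iff_of_lt {L : Ideal (MvPolynomial σ K)}
    (hL : L.IsHomogeneous (homogeneousSubmodule σ K)) {g : MvPolynomial σ K} {d : ℕ}
    (hg : g.IsHomogeneous d) {y : MvPolynomial σ K} {p : ℕ} (hy : y.IsHomogeneous p) (hp : p < d) :
    y ∈ L ⊔ Ideal.span {g} ↔ y ∈ L := by
  refine ⟨fun h => ?_, fun h => Ideal.mem_sup_left h⟩
  obtain ⟨l, hl, z, hz, rfl⟩ := Submodule.mem_sup.mp h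
  obtain ⟨b, rfl⟩ := Ideal.mem_span_singleton'.mp hz
  rw [← homogeneousComponent_eq_self hy, map_add, mul_comm,
    homogeneousComponent_mul_of_lt hg b hp, add_zero]
  exact homogeneousComponent_mem_of_mem hL hl _

theorem isHomogeneous_colon_singleton {L : Ideal (MvPolynomial σ K)}
    (hL : L.IsHomogeneous (homogeneousSubmodule σ K)) {g : MvPolynomial σ K} {d : ℕ}
    (hg : g.IsHomogeneous d) :
    (L.colon {g}).IsHomogeneous (homogeneousSubmodule σ K) := by
  rw [isHomogeneous_ideal_iff]
  intro y hy i
  rw [Submodule.mem_colon_singleton, smul_eq_mul, mul_comm] at hy ⊢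
  rw [← homogeneousComponent_mul_add hg]
  exact homogeneousComponent_mem_of_mem hL hy _

/-- The projection of the forms of degree `p` to `S / L`; its range is `(S / L)_p`. -/
noncomputable def formsToQuotient (L : Ideal (MvPolynomial σ K)) (p : ℕ) :
    homogeneousSubmodule σ K p →ₗ[K] MvPolynomial σ K ⧸ L :=
  (Ideal.Quotient.mkₐ K L).toLinearMap ∘ₗ (homogeneousSubmodule σ K p).subtype

theorem range_formsToQuotient (L : Ideal (MvPolynomial σ K)) (p : ℕ) :
    LinearMap.range (formsToQuotient L p) = gradedPiece L p := by
  rw [formsToQuotient, LinearMap.range_comp, Submodule.range_subtype, gradedPiece]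

theorem mem_ker_formsToQuotient {L : Ideal (MvPolynomial σ K)} {p : ℕ}
    {y : homogeneousSubmodule σ K p} :
    y ∈ LinearMap.ker (formsToQuotient L p) ↔ (y : MvPolynomial σ K) ∈ L := by
  rw [LinearMap.mem_ker, ← Ideal.Quotient.eq_zero_iff_mem]
  rfl

theorem isHomogeneous_ofList_ofFn {m : ℕ} {g : Fin m → MvPolynomial σ K} {e : Fin m → ℕ}
    (hg : ∀ i, (g i).IsHomogeneous (e i)) :
    (Ideal.ofList (List.ofFn g)).IsHomogeneous (homogeneousSubmodule σ K) := by
  refine Ideal.homogeneous_span _ _ fun x hx => ?_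
  obtain ⟨i, rfl⟩ := List.mem_ofFn.mp hx
  exact ⟨e i, hg i⟩

theorem MvPolynomial.IsHomogeneous.mem_pow_maxIdealOfVars {y : MvPolynomial σ K} {p : ℕ}
    (hy : y.IsHomogeneous p) {k : ℕ} (hk : k ≤ p) : y ∈ maxIdealOfVars σ K ^ k := by
  refine (mem_pow_idealOfVars_iff (σ := σ) (R := K) k y).mpr fun d hd => ?_
  rwa [Finsupp.degree_apply, ← hy.degree_eq_sum_deg_support hd]

theorem MvPolynomial.IsHomogeneous.mem_maxIdealOfVars {y : MvPolynomial σ K} {p : ℕ}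
    (hy : y.IsHomogeneous p) (hp : 0 < p) : y ∈ maxIdealOfVars σ K := by
  have := hy.mem_pow_maxIdealOfVars (k := 1) hp
  rwa [pow_one] at this

variable [Finite σ]

instance finite_homogeneousSubmodule (p : ℕ) : Module.Finite K (homogeneousSubmodule σ K p) :=
  Module.Finite.iff_fg.mpr (homogeneousSubmodule_fg σ K p)

instance finite_gradedPiece (L : Ideal (MvPolynomial σ K)) (p : ℕ) :
    Module.Finite K (gradedPiece L p) := by
  rw [← range_formsToQuotient]
  infer_instance

theorem hilbertFn_add_finrank_ker (L : Ideal (MvPolynomial σ K)) (p : ℕ) :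
    hilbertFn L p + Module.finrank K (LinearMap.ker (formsToQuotient L p)) =
      Module.finrank K (homogeneousSubmodule σ K p) := by
  rw [← LinearMap.finrank_range_add_finrank_ker (formsToQuotient L p), range_formsToQuotient,
    hilbertFn]

theorem hilbertFn_congr {L L' : Ideal (MvPolynomial σ K)} {p : ℕ}
    (h : ∀ y : MvPolynomial σ K, y.IsHomogeneous p → (y ∈ L ↔ y ∈ L')) :
    hilbertFn L p = hilbertFn L' p := by
  have h1 : LinearMap.ker (formsToQuotient L p) = LinearMap.ker (formsToQuotient L' p) := by
    ext y
    rw [mem_ker_formsToQuotient, mem_ker_formsToQuotient]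
    exact h y y.2
  have h2 := hilbertFn_add_finrank_ker L p
  have h3 := hilbertFn_add_finrank_ker L' p
  rw [h1] at h2
  lia

theorem hilbertFn_eq_zero_iff {L : Ideal (MvPolynomial σ K)} {p : ℕ} :
    hilbertFn L p = 0 ↔ ∀ y : MvPolynomial σ K, y.IsHomogeneous p → y ∈ L := by
  rw [hilbertFn, Submodule.finrank_eq_zero, eq_bot_iff, ← range_formsToQuotient,
    LinearMap.range_le_iff_comap, Submodule.comap_bot, eq_top_iff]
  refine ⟨fun h y hy => mem_ker_formsToQuotient.mp (h (x := ⟨y, hy⟩) trivial), fun h y _ =>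
    mem_ker_formsToQuotient.mpr (h y y.2)⟩

/-- The Hilbert functions in `0 → S / (L : g) (-d) → S / L → S / (L + (g)) → 0`. -/
theorem hilbertFn_add {L : Ideal (MvPolynomial σ K)}
    (hL : L.IsHomogeneous (homogeneousSubmodule σ K)) {g : MvPolynomial σ K} {d : ℕ}
    (hg : g.IsHomogeneous d) (p : ℕ) :
    hilbertFn L (d + p) = hilbertFn (L ⊔ Ideal.span {g}) (d + p) + hilbertFn (L.colon {g}) p := by
  -- `ψ` is multiplication by `g`, from `S_p` to `(S / L)_{d + p}`
  let ψ : homogeneousSubmodule σ K p →ₗ[K] gradedPiece L (d + p) :=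
    LinearMap.codRestrict _ ((Ideal.Quotient.mkₐ K L).toLinearMap ∘ₗ LinearMap.mulLeft K g ∘ₗ
      (homogeneousSubmodule σ K p).subtype) (fun y =>
        Submodule.mem_map_of_mem (hg.mul ((mem_homogeneousSubmodule _ _).mp y.2)))
  let θ : gradedPiece L (d + p) →ₗ[K] MvPolynomial σ K ⧸ (L ⊔ Ideal.span {g}) :=
    (Ideal.Quotient.factorₐ K (le_sup_left : L ≤ L ⊔ Ideal.span {g})).toLinearMap ∘ₗ
      (gradedPiece L (d + p)).subtype
  have hθr : LinearMap.range θ = gradedPiece (L ⊔ Ideal.span {g}) (d + p) := by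
    rw [LinearMap.range_comp, Submodule.range_subtype, gradedPiece, gradedPiece,
      ← Submodule.map_comp]
    rfl
  have hθk : LinearMap.ker θ = LinearMap.range ψ := by
    ext ⟨x, hx⟩
    obtain ⟨y, hy, rfl⟩ := hx
    have h1 : (⟨_, ⟨y, hy, rfl⟩⟩ : gradedPiece L (d + p)) ∈ LinearMap.ker θ ↔
        y ∈ L ⊔ Ideal.span {g} := by
      rw [← Ideal.Quotient.eq_zero_iff_mem]
      rfl
    rw [h1, mem_sup_span_singleton_iff hL hg hy]
    constructor
    · rintro ⟨b, hb, h⟩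
      refine ⟨⟨b, hb⟩, Subtype.ext ?_⟩
      exact ((Ideal.Quotient.mk_eq_mk_iff_sub_mem _ _).mpr h).symm
    · rintro ⟨b, hb⟩
      refine ⟨b, b.2, ?_⟩
      exact (Ideal.Quotient.mk_eq_mk_iff_sub_mem _ _).mp (congrArg Subtype.val hb).symm
  have hψk : LinearMap.ker ψ = LinearMap.ker (formsToQuotient (L.colon {g}) p) := by
    ext y
    rw [mem_ker_formsToQuotient, Submodule.mem_colon_singleton, smul_eq_mul, mul_comm,
      ← Ideal.Quotient.eq_zero_iff_mem, LinearMap.mem_ker, Subtype.ext_iff]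
    rfl
  have h1 := LinearMap.finrank_range_add_finrank_ker θ
  have h2 := LinearMap.finrank_range_add_finrank_ker ψ
  have h3 := hilbertFn_add_finrank_ker (L.colon {g}) p
  rw [hθr, hθk] at h1
  rw [hψk] at h2
  unfold hilbertFn at *
  lia

theorem hilbertFn_sup_of_lt {L : Ideal (MvPolynomial σ K)}
    (hL : L.IsHomogeneous (homogeneousSubmodule σ K)) {g : MvPolynomial σ K} {d : ℕ}
    (hg : g.IsHomogeneous d) {p : ℕ} (hp : p < d) :
    hilbertFn (L ⊔ Ideal.span {g}) p = hilbertFn L p :=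
  hilbertFn_congr fun _ hy => mem_sup_span_singleton_iff_of_lt hL hg hy hp

theorem quotientHilbertSeries_eq_add {L : Ideal (MvPolynomial σ K)}
    (hL : L.IsHomogeneous (homogeneousSubmodule σ K)) {g : MvPolynomial σ K} {d : ℕ}
    (hg : g.IsHomogeneous d) :
    quotientHilbertSeries L = quotientHilbertSeries (L ⊔ Ideal.span {g}) +
      PowerSeries.X ^ d * quotientHilbertSeries (L.colon {g}) := by
  ext q
  rw [map_add, PowerSeries.coeff_X_pow_mul', coeff_quotientHilbertSeries,
    coeff_quotientHilbertSeries]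
  split_ifs with hq
  · obtain ⟨p, rfl⟩ := Nat.exists_eq_add_of_le hq
    rw [coeff_quotientHilbertSeries, hilbertFn_add hL hg, add_tsub_cancel_left]
    push_cast
    rfl
  · rw [hilbertFn_sup_of_lt hL hg (by lia), add_zero]

theorem colon_singleton_eq_self {R : Type*} [CommRing R] {L : Ideal R} {g : R}
    (h : ∀ y, g * y ∈ L → y ∈ L) : L.colon {g} = L := by
  ext y
  rw [Submodule.mem_colon_singleton, smul_eq_mul, mul_comm]
  exact ⟨h y, fun hy => Ideal.mul_mem_left _ _ hy⟩

theorem quotientHilbertSeries_sup_span_singleton {L : Ideal (MvPolynomial σ K)}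
    (hL : L.IsHomogeneous (homogeneousSubmodule σ K)) {g : MvPolynomial σ K} {d : ℕ}
    (hg : g.IsHomogeneous d) (hreg : ∀ y, g * y ∈ L → y ∈ L) :
    quotientHilbertSeries (L ⊔ Ideal.span {g}) =
      (1 - PowerSeries.X ^ d) * quotientHilbertSeries L := by
  have h := quotientHilbertSeries_eq_add hL hg
  rw [colon_singleton_eq_self hreg] at h
  rw [sub_mul, one_mul, eq_sub_iff_add_eq]
  exact h.symm

theorem quotientHilbertSeries_ofList_ofFn {m : ℕ} {g : Fin m → MvPolynomial σ K} {e : Fin m → ℕ}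
    (hg : ∀ i, (g i).IsHomogeneous (e i))
    (hreg : IsWeaklyRegular (MvPolynomial σ K) (List.ofFn g)) :
    quotientHilbertSeries (Ideal.ofList (List.ofFn g)) =
      (∏ i, (1 - PowerSeries.X ^ e i)) *
        quotientHilbertSeries (⊥ : Ideal (MvPolynomial σ K)) := by
  induction m with
  | zero => simp
  | succ m ih =>
    rw [List.ofFn_succ', List.concat_eq_append, isWeaklyRegular_concat_iff] at hreg
    rw [List.ofFn_succ', List.concat_eq_append, Ideal.ofList_append, Ideal.ofList_singleton,
      quotientHilbertSeries_sup_span_singleton (isHomogeneous_ofList_ofFn fun i => hg i.castSucc)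
        (hg (Fin.last m)) hreg.2, ih (fun i => hg i.castSucc) hreg.1, Fin.prod_univ_castSucc]
    ring

theorem quotientHilbertSeries_maxIdealOfVars :
    quotientHilbertSeries (maxIdealOfVars σ K) = 1 := by
  ext p
  rw [coeff_quotientHilbertSeries, PowerSeries.coeff_one]
  split_ifs with hp
  · subst hp
    norm_cast
    have : Module.Free K (gradedPiece (maxIdealOfVars σ K) 0) := Module.Free.of_divisionRing K _
    rw [hilbertFn, finrank_eq_one_iff']
    refine ⟨⟨1, ⟨1, isHomogeneous_one _ _, rfl⟩⟩, ?_, ?_⟩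
    · intro h
      have h1 := congrArg Subtype.val h
      exact maxIdealOfVars_isMaximal.ne_top
        ((Ideal.eq_top_iff_one _).mpr (Ideal.Quotient.eq_zero_iff_mem.mp h1))
    · rintro ⟨_, y, hy, rfl⟩
      obtain ⟨c, hc⟩ : ∃ c : K, y = C c :=
        ⟨_, totalDegree_eq_zero_iff_eq_C.mp (Nat.le_zero.mp hy.totalDegree_le)⟩
      refine ⟨c, Subtype.ext ?_⟩
      change c • (1 : MvPolynomial σ K ⧸ maxIdealOfVars σ K) = Ideal.Quotient.mk _ y
      rw [hc, ← Algebra.algebraMap_eq_smul_one]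
      rfl
  · exact_mod_cast hilbertFn_eq_zero_iff.mpr fun y hy => hy.mem_maxIdealOfVars (by lia)

/-- The Hilbert series of the polynomial ring in `m` variables is `1 / (1 - t) ^ m`. -/
theorem one_sub_X_pow_mul_quotientHilbertSeries_bot (m : ℕ) :
    (1 - PowerSeries.X) ^ m *
      quotientHilbertSeries (⊥ : Ideal (MvPolynomial (Fin m) K)) = 1 := by
  have h := quotientHilbertSeries_ofList_ofFn (e := fun _ => 1) (fun i => isHomogeneous_X K i)
    (isWeaklyRegular_ofFn_X K m)
  rw [ofList_ofFn_X, quotientHilbertSeries_maxIdealOfVars] at h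
  simpa using h.symm

end HilbertFunction

/-! ### Homogeneous prime avoidance -/

section PrimeAvoidance

open MvPolynomial

attribute [local instance] MvPolynomial.gradedAlgebra

variable {σ : Type*} {K : Type*} [Field K]

/-- Homogeneous prime avoidance, in every large degree: finitely many homogeneous primes, none of
them containing `𝔪`, are avoided by a form of each sufficiently large degree. -/
theorem exists_isHomogeneous_forall_notMem (T : Finset (Ideal (MvPolynomial σ K)))
    (hT : ∀ P ∈ T, P.IsPrime ∧ P.IsHomogeneous (homogeneousSubmodule σ K) ∧
      ¬ maxIdealOfVars σ K ≤ P) :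
    ∃ E : ℕ, ∀ e ≥ E, ∃ h : MvPolynomial σ K, h.IsHomogeneous e ∧ ∀ P ∈ T, h ∉ P := by
  classical
  induction hk : T.card generalizing T with
  | zero =>
    rw [Finset.card_eq_zero] at hk
    subst hk
    exact ⟨0, fun e _ => ⟨0, isHomogeneous_zero _ _ _, by simp⟩⟩
  | succ k ih =>
    obtain ⟨P, T', hP, rfl, hT'⟩ := Finset.card_eq_succ.mp hk
    obtain ⟨hPp, hPh, hPm⟩ := hT P (Finset.mem_insert_self _ _)
    by_cases hu : ∃ (u : MvPolynomial σ K) (a : ℕ), u.IsHomogeneous a ∧ (∀ Q ∈ T', u ∈ Q) ∧ u ∉ P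
    · obtain ⟨u, a, hua, huT, huP⟩ := hu
      obtain ⟨i, hi⟩ : ∃ i : σ, (X i : MvPolynomial σ K) ∉ P := by
        by_contra! hall
        refine hPm (Ideal.span_le.mpr ?_)
        rintro _ ⟨i, rfl⟩
        exact hall i
      obtain ⟨E, hE⟩ := ih T' (fun Q hQ => hT Q (Finset.mem_insert_of_mem hQ)) hT'
      refine ⟨max E a, fun e he => ?_⟩
      obtain ⟨h, hh, hhT⟩ := hE e (le_of_max_le_left he)
      by_cases hhP : h ∈ P
      · have hae : a ≤ e := le_of_max_le_right he
        refine ⟨h + u * X i ^ (e - a), hh.add ?_, fun Q hQ => ?_⟩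
        · have := hua.mul (isHomogeneous_X_pow (R := K) i (e - a))
          rwa [Nat.add_sub_cancel' hae] at this
        · rcases Finset.mem_insert.mp hQ with rfl | hQ
          · rw [Ideal.add_mem_iff_right _ hhP]
            exact fun hmem => (hPp.mem_or_mem hmem).elim huP fun h => hi (hPp.mem_of_pow_mem _ h)
          · rw [Ideal.add_mem_iff_left _ (Ideal.mul_mem_right _ _ (huT Q hQ))]
            exact hhT Q hQ
      · refine ⟨h, hh, fun Q hQ => ?_⟩
        rcases Finset.mem_insert.mp hQ with rfl | hQ
        · exact hhP
        · exact hhT Q hQ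
    · -- otherwise some `Q ∈ T'` lies in `P` and can be dropped
      push Not at hu
      have hle : T'.inf id ≤ P := by
        intro y hy
        rw [mem_iff_homogeneousComponent_mem hPh]
        intro i
        refine hu _ i (homogeneousComponent_isHomogeneous _ _) fun Q hQ => ?_
        refine homogeneousComponent_mem_of_mem (hT Q (Finset.mem_insert_of_mem hQ)).2.1 ?_ i
        exact (Finset.inf_le hQ : T'.inf id ≤ id Q) hy
      obtain ⟨Q, hQ, hQP⟩ := (Ideal.IsPrime.inf_le' hPp).mp hle
      have hcard : (insert P (T'.erase Q)).card = k := by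
        rw [Finset.card_insert_of_notMem (fun h => hP (Finset.mem_of_mem_erase h)),
          Finset.card_erase_of_mem hQ, hT']
        have := Finset.card_pos.mpr ⟨Q, hQ⟩
        lia
      obtain ⟨E, hE⟩ := ih (insert P (T'.erase Q)) (fun R hR => hT R (by
        rcases Finset.mem_insert.mp hR with rfl | hR
        · exact Finset.mem_insert_self _ _
        · exact Finset.mem_insert_of_mem (Finset.mem_of_mem_erase hR))) hcard
      refine ⟨E, fun e he => ?_⟩
      obtain ⟨h, hh, hhT⟩ := hE e he
      refine ⟨h, hh, fun R hR hmem => ?_⟩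
      rcases Finset.mem_insert.mp hR with rfl | hR
      · exact hhT R (Finset.mem_insert_self _ _) hmem
      · by_cases hRQ : R = Q
        · exact hhT P (Finset.mem_insert_self _ _) (hQP (hRQ ▸ hmem))
        · exact hhT R (Finset.mem_insert_of_mem (Finset.mem_erase.mpr ⟨hRQ, hR⟩)) hmem

/-- `S / L` has no nonzero element killed by `𝔪`. -/
def IsSaturatedIdeal (L : Ideal (MvPolynomial σ K)) : Prop :=
  ∀ y, (∀ a ∈ maxIdealOfVars σ K, a * y ∈ L) → y ∈ L

theorem IsSaturatedIdeal.not_le_of_mem_associatedPrimes [Finite σ]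
    {L : Ideal (MvPolynomial σ K)} (hL : IsSaturatedIdeal L) {P : Ideal (MvPolynomial σ K)}
    (hP : P ∈ associatedPrimes (MvPolynomial σ K) (MvPolynomial σ K ⧸ L)) :
    ¬ maxIdealOfVars σ K ≤ P := by
  intro hle
  rw [AssociatedPrimes.mem_iff, isAssociatedPrime_iff] at hP
  obtain ⟨hPp, x, rfl⟩ := hP
  obtain ⟨y, rfl⟩ := Ideal.Quotient.mk_surjective x
  have hy : y ∈ L := hL y fun a ha => by
    have h := hle ha
    rw [Submodule.mem_colon_singleton, Submodule.mem_bot] at h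
    exact Ideal.Quotient.eq_zero_iff_mem.mp h
  refine hPp.ne_top ((Ideal.eq_top_iff_one _).mpr ?_)
  rw [Submodule.mem_colon_singleton, Submodule.mem_bot, one_smul]
  exact Ideal.Quotient.eq_zero_iff_mem.mpr hy

/-- In every large degree, there is a form that is a nonzerodivisor modulo two given ideals, none of
which has `𝔪` as an associated prime. -/
theorem exists_isHomogeneous_regular [Finite σ] {L L' : Ideal (MvPolynomial σ K)}
    (hL : IsSaturatedIdeal L) (hL' : IsSaturatedIdeal L') :
    ∃ E : ℕ, ∀ e ≥ E, ∃ h : MvPolynomial σ K, h.IsHomogeneous e ∧ (∀ y, h * y ∈ L → y ∈ L) ∧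
      ∀ y, h * y ∈ L' → y ∈ L' := by
  classical
  have hfin : ∀ M : Ideal (MvPolynomial σ K),
      (associatedPrimes (MvPolynomial σ K) (MvPolynomial σ K ⧸ M)).Finite :=
    fun M => associatedPrimes.finite _ _
  let T := ((hfin L).toFinset ∪ (hfin L').toFinset).image
    fun P => (P.homogeneousCore (homogeneousSubmodule σ K)).toIdeal
  obtain ⟨E, hE⟩ := exists_isHomogeneous_forall_notMem T (by
    intro P hP
    obtain ⟨Q, hQ, rfl⟩ := Finset.mem_image.mp hP
    rw [Finset.mem_union, Set.Finite.mem_toFinset, Set.Finite.mem_toFinset] at hQ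
    have hQp : Q.IsPrime := hQ.elim (fun h => h.1) (fun h => h.1)
    refine ⟨hQp.homogeneousCore, HomogeneousIdeal.isHomogeneous _, fun hle => ?_⟩
    have hle' := hle.trans (Ideal.toIdeal_homogeneousCore_le _ Q)
    exact hQ.elim (fun h => hL.not_le_of_mem_associatedPrimes h hle')
      (fun h => hL'.not_le_of_mem_associatedPrimes h hle'))
  refine ⟨E, fun e he => ?_⟩
  obtain ⟨h, hh, hhT⟩ := hE e he
  have key : ∀ M : Ideal (MvPolynomial σ K),
      (∀ P ∈ associatedPrimes (MvPolynomial σ K) (MvPolynomial σ K ⧸ M), h ∉ P) →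
      ∀ y, h * y ∈ M → y ∈ M := by
    intro M hM y hy
    by_contra hyM
    have hmem : h ∈ {r : MvPolynomial σ K | ∃ x : MvPolynomial σ K ⧸ M, x ≠ 0 ∧ r • x = 0} :=
      ⟨Ideal.Quotient.mk M y, fun h0 => hyM (Ideal.Quotient.eq_zero_iff_mem.mp h0),
        Ideal.Quotient.eq_zero_iff_mem.mpr hy⟩
    rw [← biUnion_associatedPrimes_eq_zero_divisors] at hmem
    obtain ⟨P, hP, hhP⟩ := Set.mem_iUnion₂.mp hmem
    exact hM P hP hhP
  have hcore : ∀ P ∈ (hfin L).toFinset ∪ (hfin L').toFinset, h ∉ P := fun P hP hhP =>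
    hhT _ (Finset.mem_image_of_mem _ hP)
      (Ideal.mem_homogeneousCore_of_homogeneous_of_mem ⟨e, hh⟩ hhP)
  exact ⟨h, hh, key L fun P hP => hcore P (by simp [hP]), key L' fun P hP => hcore P (by simp [hP])⟩

end PrimeAvoidance

/-! ### Symmetry of Hilbert functions of graded Artinian Gorenstein quotients -/

section Symmetry

open MvPolynomial

attribute [local instance] MvPolynomial.gradedAlgebra

variable {σ : Type*} {K : Type*} [Field K] {L : Ideal (MvPolynomial σ K)}

theorem mul_mem_of_forall_X_mul_mem {y : MvPolynomial σ K} (h : ∀ i, X i * y ∈ L) :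
    ∀ a ∈ maxIdealOfVars σ K, a * y ∈ L := by
  intro a ha
  have hle : maxIdealOfVars σ K ≤ L.colon {y} := by
    refine Ideal.span_le.mpr ?_
    rintro _ ⟨i, rfl⟩
    exact Submodule.mem_colon_singleton.mpr (h i)
  exact Submodule.mem_colon_singleton.mp (hle ha)

/-- The pairing `(S / L)_p × (S / L)_q → (S / L)_s`, `p + q = s`, is nondegenerate if `S / L` has
a simple socle, in degree `s`. -/
theorem exists_mul_notMem_of_hasCyclicSocle (hL : L.IsHomogeneous (homogeneousSubmodule σ K))
    (hsoc : HasCyclicSocle (maxIdealOfVars σ K) L) {s : ℕ} {z : MvPolynomial σ K}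
    (hz : z.IsHomogeneous s) (hzL : z ∉ L)
    (htop : ∀ y : MvPolynomial σ K, y.IsHomogeneous (s + 1) → y ∈ L) (q : ℕ) {p : ℕ}
    (hpq : p + q = s) {y : MvPolynomial σ K} (hy : y.IsHomogeneous p) (hyL : y ∉ L) :
    ∃ w : MvPolynomial σ K, w.IsHomogeneous q ∧ y * w ∉ L := by
  induction q generalizing p y with
  | zero => exact ⟨1, isHomogeneous_one _ _, by rwa [mul_one]⟩
  | succ q ih =>
    obtain ⟨i, hi⟩ : ∃ i, X i * y ∉ L := by
      by_contra! hall
      -- `y` and `z` are both in the socle, but have different degrees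
      obtain ⟨c, hc⟩ := hsoc y z (mul_mem_of_forall_X_mul_mem hall)
        (mul_mem_of_forall_X_mul_mem fun i => htop _ (by
          have := (isHomogeneous_X K i).mul hz
          rwa [add_comm] at this)) hzL
      have h := homogeneousComponent_mem_of_mem hL hc p
      rw [map_sub, homogeneousComponent_eq_self hy, mul_comm,
        homogeneousComponent_mul_of_lt hz _ (by lia), sub_zero] at h
      exact hyL h
    obtain ⟨w, hw, hwL⟩ := ih (p := 1 + p) (by lia) ((isHomogeneous_X K i).mul hy) hi
    refine ⟨X i * w, ?_, by rwa [mul_left_comm, ← mul_assoc]⟩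
    have := (isHomogeneous_X K i).mul hw
    rwa [add_comm] at this

variable [Finite σ]

theorem hilbertFn_le_of_hasCyclicSocle (hL : L.IsHomogeneous (homogeneousSubmodule σ K))
    (hsoc : HasCyclicSocle (maxIdealOfVars σ K) L) {s : ℕ} (hs : hilbertFn L s ≠ 0)
    (htop : hilbertFn L (s + 1) = 0) {p q : ℕ} (hpq : p + q = s) :
    hilbertFn L p ≤ hilbertFn L q := by
  rw [hilbertFn_eq_zero_iff] at htop
  rw [Ne, hilbertFn_eq_zero_iff] at hs
  push Not at hs
  obtain ⟨z, hz, hzL⟩ := hs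
  have hzX : ∀ a ∈ maxIdealOfVars σ K, a * z ∈ L := mul_mem_of_forall_X_mul_mem fun i =>
    htop _ (by
      have := (isHomogeneous_X K i).mul hz
      rwa [add_comm] at this)
  have hfree : ∀ r, Module.Free K (gradedPiece L r) := fun r => Module.Free.of_divisionRing K _
  -- `(S / L)_s` is spanned by the class of `z`
  have h1 : Module.finrank K (gradedPiece L s) ≤ 1 := by
    refine finrank_le_one ⟨Ideal.Quotient.mk L z, ⟨z, hz, rfl⟩⟩ ?_
    rintro ⟨_, y, hy, rfl⟩
    have hy' : y.IsHomogeneous s := hy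
    obtain ⟨c, hc⟩ := hsoc y z (mul_mem_of_forall_X_mul_mem fun i => htop _ (by
      have := (isHomogeneous_X K i).mul hy'
      rwa [add_comm] at this)) hzX hzL
    have h := homogeneousComponent_mem_of_mem hL hc (s + 0)
    rw [map_sub, mul_comm, homogeneousComponent_mul_add hz, homogeneousComponent_zero, add_zero,
      homogeneousComponent_eq_self hy'] at h
    refine ⟨coeff 0 c, Subtype.ext ?_⟩
    have h2 := (Ideal.Quotient.mk_eq_mk_iff_sub_mem _ _).mpr h
    change coeff 0 c • Ideal.Quotient.mk L z = Ideal.Quotient.mk L y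
    rw [h2, mul_comm, map_mul]
    exact Algebra.smul_def (coeff 0 c) (Ideal.Quotient.mk L z)
  have hmul : ∀ (x : gradedPiece L p) (w : gradedPiece L q),
      (x : MvPolynomial σ K ⧸ L) * (w : MvPolynomial σ K ⧸ L) ∈ gradedPiece L s := by
    rintro ⟨_, y, hy, rfl⟩ ⟨_, w, hw, rfl⟩
    refine ⟨y * w, ?_, rfl⟩
    rw [← hpq]
    exact IsHomogeneous.mul hy hw
  let B : gradedPiece L p →ₗ[K] gradedPiece L q →ₗ[K] gradedPiece L s :=
    LinearMap.mk₂ K (fun x w => ⟨_, hmul x w⟩)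
      (fun x y w => Subtype.ext (add_mul _ _ _))
      (fun c x w => Subtype.ext (smul_mul_assoc _ _ _))
      (fun x w w' => Subtype.ext (mul_add _ _ _))
      (fun c x w => Subtype.ext (mul_smul_comm _ _ _))
  have hB : Function.Injective B := by
    rw [injective_iff_map_eq_zero]
    rintro ⟨_, y, hy, rfl⟩ h0
    refine Subtype.ext ?_
    refine Ideal.Quotient.eq_zero_iff_mem.mpr ?_
    by_contra hyL
    obtain ⟨w, hw, hwL⟩ := exists_mul_notMem_of_hasCyclicSocle hL hsoc hz hzL htop q hpq hy hyL
    have h2 := congrArg Subtype.val (LinearMap.congr_fun h0 ⟨Ideal.Quotient.mk L w, ⟨w, hw, rfl⟩⟩)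
    exact hwL (Ideal.Quotient.eq_zero_iff_mem.mp h2)
  have hfin : Module.Finite K (gradedPiece L q →ₗ[K] gradedPiece L s) :=
    Module.Finite.linearMap K K _ _
  have h2 := LinearMap.finrank_le_finrank_of_injective hB
  rw [Module.finrank_linearMap] at h2
  exact h2.trans ((Nat.mul_le_mul_left _ h1).trans_eq (mul_one _))

theorem hilbertFn_symm_of_hasCyclicSocle (hL : L.IsHomogeneous (homogeneousSubmodule σ K))
    (hsoc : HasCyclicSocle (maxIdealOfVars σ K) L) {s : ℕ} (hs : hilbertFn L s ≠ 0)
    (htop : hilbertFn L (s + 1) = 0) {p q : ℕ} (hpq : p + q = s) :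
    hilbertFn L p = hilbertFn L q :=
  le_antisymm (hilbertFn_le_of_hasCyclicSocle hL hsoc hs htop hpq)
    (hilbertFn_le_of_hasCyclicSocle hL hsoc hs htop (by lia))

/-- `S / (L : g)` is isomorphic to the ideal `g` of `S / L`, so it inherits a simple socle. -/
theorem HasCyclicSocle.colon_singleton {R : Type*} [CommRing R] {m L : Ideal R}
    (h : HasCyclicSocle m L) (g : R) : HasCyclicSocle m (L.colon {g}) := by
  intro y z hy hz hz0
  simp only [Submodule.mem_colon_singleton, smul_eq_mul] at hy hz hz0 ⊢
  obtain ⟨c, hc⟩ := h (y * g) (z * g) (fun a ha => by rw [← mul_assoc]; exact hy a ha)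
    (fun a ha => by rw [← mul_assoc]; exact hz a ha) hz0
  exact ⟨c, by rwa [sub_mul, mul_assoc]⟩

/-- For `S / L` with a simple socle, in degree `s`, the Hilbert function of `S / (L : g)`
is symmetric about `(s - d) / 2`, for a form `g` of degree `d`. -/
theorem hilbertFn_colon_symm (hL : L.IsHomogeneous (homogeneousSubmodule σ K))
    (hsoc : HasCyclicSocle (maxIdealOfVars σ K) L) {s : ℕ} (hs : hilbertFn L s ≠ 0)
    (htop : hilbertFn L (s + 1) = 0) {g : MvPolynomial σ K} {d : ℕ} (hg : g.IsHomogeneous d)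
    {p q : ℕ} (hpq : d + p + q = s) :
    hilbertFn (L.colon {g}) p = hilbertFn (L.colon {g}) q := by
  by_cases hgL : g ∈ L
  · have htop : L.colon {g} = ⊤ := by
      rw [Submodule.colon_eq_top_iff_subset, Set.singleton_subset_iff]
      exact hgL
    rw [htop, hilbertFn_eq_zero_iff.mpr fun y _ => Submodule.mem_top,
      hilbertFn_eq_zero_iff.mpr fun y _ => Submodule.mem_top]
  · have htop' := hilbertFn_eq_zero_iff.mp htop
    obtain ⟨z, hz, hzL⟩ : ∃ z : MvPolynomial σ K, z.IsHomogeneous s ∧ z ∉ L := by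
      by_contra! hall
      exact hs (hilbertFn_eq_zero_iff.mpr hall)
    obtain ⟨w, hw, hwL⟩ := exists_mul_notMem_of_hasCyclicSocle hL hsoc hz hzL htop' (p + q)
      (by lia) hg hgL
    refine hilbertFn_symm_of_hasCyclicSocle (isHomogeneous_colon_singleton hL hg)
      (hsoc.colon_singleton g) (s := p + q) ?_ ?_ rfl
    · intro h0
      have := hilbertFn_eq_zero_iff.mp h0 w hw
      rw [Submodule.mem_colon_singleton, smul_eq_mul, mul_comm] at this
      exact hwL this
    · rw [hilbertFn_eq_zero_iff]
      intro y hy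
      rw [Submodule.mem_colon_singleton, smul_eq_mul, mul_comm]
      refine htop' _ ?_
      have := hg.mul hy
      rwa [show d + (p + q + 1) = s + 1 by lia] at this

end Symmetry

/-! ### Saturation -/

section Saturation

open MvPolynomial

attribute [local instance] MvPolynomial.gradedAlgebra

variable {σ : Type*} {K : Type*} [Field K]

theorem isHomogeneous_saturationIdeal {J : Ideal (MvPolynomial σ K)}
    (hJ : J.IsHomogeneous (homogeneousSubmodule σ K)) :
    (saturationIdeal J).IsHomogeneous (homogeneousSubmodule σ K) := by
  refine Ideal.IsHomogeneous.iSup fun k => ?_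
  rw [isHomogeneous_ideal_iff]
  intro y hy i
  rw [maxIdealOfVars, show (Ideal.span (Set.range X) : Ideal (MvPolynomial σ K)) =
    idealOfVars σ K from rfl, pow_idealOfVars_eq_span, Ideal.colon_span] at hy ⊢
  rw [Submodule.mem_colon] at hy ⊢
  rintro _ ⟨d, hd, rfl⟩
  have h := homogeneousComponent_mem_of_mem hJ (hy _ ⟨d, hd, rfl⟩) (k + i)
  have hmon : (monomial d (1 : K)).IsHomogeneous k := isHomogeneous_monomial _ hd
  rw [smul_eq_mul, mul_comm] at h ⊢
  rwa [homogeneousComponent_mul_add hmon] at h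

variable [Finite σ] (J : Ideal (MvPolynomial σ K))

theorem exists_saturationIdeal_eq_colon : ∃ k : ℕ, saturationIdeal J =
    J.colon ((maxIdealOfVars σ K ^ k : Ideal (MvPolynomial σ K)) : Set (MvPolynomial σ K)) := by
  let c : ℕ →o Ideal (MvPolynomial σ K) :=
    ⟨fun k => J.colon ((maxIdealOfVars σ K ^ k : Ideal (MvPolynomial σ K)) :
      Set (MvPolynomial σ K)),
      fun _ _ hab => Submodule.colon_mono le_rfl (Ideal.pow_le_pow_right hab)⟩
  obtain ⟨k, hk⟩ := monotone_stabilizes_iff_noetherian.mpr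
    (inferInstance : IsNoetherian (MvPolynomial σ K) (MvPolynomial σ K)) c
  refine ⟨k, le_antisymm (iSup_le fun j => ?_) (le_iSup c k)⟩
  rcases le_total k j with h | h
  · exact (hk j h).ge
  · exact c.mono h

theorem le_saturationIdeal : J ≤ saturationIdeal J := by
  obtain ⟨k, hk⟩ := exists_saturationIdeal_eq_colon J
  rw [hk]
  exact Ideal.le_colon

theorem isSaturatedIdeal_saturationIdeal : IsSaturatedIdeal (saturationIdeal J) := by
  intro y hy
  obtain ⟨k, hk⟩ := exists_saturationIdeal_eq_colon J
  rw [hk] at hy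
  refine (le_iSup (fun k => J.colon ((maxIdealOfVars σ K ^ k : Ideal (MvPolynomial σ K)) :
    Set (MvPolynomial σ K))) (k + 1)) ?_
  rw [Submodule.mem_colon]
  intro t ht
  rw [SetLike.mem_coe, pow_succ] at ht
  rw [smul_eq_mul]
  refine Submodule.mul_induction_on ht (fun a ha b hb => ?_) fun a b ha hb => ?_
  · have := Submodule.mem_colon.mp (hy b hb) a ha
    rw [smul_eq_mul] at this
    convert this using 1
    ring
  · rw [mul_add]
    exact Ideal.add_mem _ ha hb

variable {J}

/-- A homogeneous ideal and its saturation agree in all large degrees. -/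
theorem exists_forall_mem_saturationIdeal_iff (hJ : J.IsHomogeneous (homogeneousSubmodule σ K)) :
    ∃ q₀ : ℕ, ∀ q ≥ q₀, ∀ y : MvPolynomial σ K, y.IsHomogeneous q →
      (y ∈ saturationIdeal J ↔ y ∈ J) := by
  obtain ⟨k, hk⟩ := exists_saturationIdeal_eq_colon J
  obtain ⟨T, hT⟩ := (inferInstance : IsNoetherianRing (MvPolynomial σ K)).noetherian
    (saturationIdeal J)
  let D := T.sup totalDegree
  -- modulo `J`, the ideal is spanned by polynomials of degree at most `k + D`
  have key : ∀ z ∈ saturationIdeal J, ∀ a : MvPolynomial σ K,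
      ∃ w : MvPolynomial σ K, w.totalDegree ≤ k + D ∧ a * z - w ∈ J := by
    intro z hz
    rw [← hT] at hz
    induction hz using Submodule.span_induction with
    | mem t ht =>
      intro a
      refine ⟨(∑ i ∈ Finset.range k, homogeneousComponent i a) * t, ?_, ?_⟩
      · refine (totalDegree_mul _ _).trans (Nat.add_le_add ?_ (Finset.le_sup ht))
        refine totalDegree_finsetSum_le fun i hi => ?_
        exact (homogeneousComponent_isHomogeneous i a).totalDegree_le.trans
          (Finset.mem_range.mp hi).le
      · have hlow : a - ∑ i ∈ Finset.range k, homogeneousComponent i a ∈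
            maxIdealOfVars σ K ^ k := by
          refine (mem_pow_idealOfVars_iff' (σ := σ) (R := K) k _).mpr fun x hx => ?_
          rw [coeff_sub, coeff_sum]
          simp only [coeff_homogeneousComponent]
          rw [Finset.sum_ite_eq, if_pos (Finset.mem_range.mpr hx), sub_self]
        have htI : t ∈ saturationIdeal J := hT ▸ Submodule.subset_span ht
        rw [hk, Submodule.mem_colon] at htI
        have := htI _ hlow
        rwa [smul_eq_mul, mul_comm, sub_mul] at this
    | zero => exact fun a => ⟨0, by simp, by simp⟩
    | add x y _ _ hx hy =>
      intro a
      obtain ⟨w, hw, hwJ⟩ := hx a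
      obtain ⟨v, hv, hvJ⟩ := hy a
      refine ⟨w + v, (totalDegree_add _ _).trans (max_le hw hv), ?_⟩
      rw [mul_add, add_sub_add_comm]
      exact Ideal.add_mem _ hwJ hvJ
    | smul b x _ hx =>
      intro a
      rw [smul_eq_mul, ← mul_assoc]
      exact hx (a * b)
  refine ⟨k + D + 1, fun q hq y hy => ⟨fun hyI => ?_, fun h => le_saturationIdeal J h⟩⟩
  obtain ⟨w, hw, hwJ⟩ := key y hyI 1
  have h := homogeneousComponent_mem_of_mem hJ hwJ q
  rwa [one_mul, map_sub, homogeneousComponent_eq_self hy,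
    homogeneousComponent_eq_zero _ _ (by lia), sub_zero] at h

theorem saturationIdeal_ne_top (h : ringKrullDim (MvPolynomial σ K ⧸ J) = 1) :
    saturationIdeal J ≠ ⊤ := by
  intro htop
  obtain ⟨k, hk⟩ := exists_saturationIdeal_eq_colon J
  have hle : maxIdealOfVars σ K ^ k ≤ J := by
    intro t ht
    have h1 : (1 : MvPolynomial σ K) ∈ saturationIdeal J := htop ▸ trivial
    rw [hk, Submodule.mem_colon] at h1
    simpa using h1 t ht
  have h0 : Ring.KrullDimLE 0 (MvPolynomial σ K ⧸ J) := by
    rw [Ring.krullDimLE_zero_iff]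
    intro P hP
    have hPc : (P.comap (Ideal.Quotient.mk J)).IsPrime := inferInstance
    have hm : maxIdealOfVars σ K ≤ P.comap (Ideal.Quotient.mk J) := by
      refine Ideal.IsPrime.le_of_pow_le (n := k) (hle.trans ?_)
      intro t ht
      rw [Ideal.mem_comap, Ideal.Quotient.eq_zero_iff_mem.mpr ht]
      exact P.zero_mem
    have heq := maxIdealOfVars_isMaximal.eq_of_le hPc.ne_top hm
    have hmax : (P.comap (Ideal.Quotient.mk J)).IsMaximal := heq ▸ maxIdealOfVars_isMaximal
    have h2 := Ideal.map_eq_top_or_isMaximal_of_surjective (Ideal.Quotient.mk J)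
      Ideal.Quotient.mk_surjective hmax
    rw [Ideal.map_comap_of_surjective _ Ideal.Quotient.mk_surjective] at h2
    exact h2.resolve_left hP.ne_top
  rw [Ring.krullDimLE_iff, h] at h0
  exact absurd h0 (by norm_num)

end Saturation

/-! ### Complete intersections of dimension one -/

section CompleteIntersection

open MvPolynomial RingTheory.Sequence

attribute [local instance] MvPolynomial.gradedAlgebra

/-- The polynomial `1 + t + ⋯ + t ^ (e - 1)`. -/
noncomputable def geomPoly (e : ℕ) : Polynomial ℤ := ∑ i ∈ Finset.range e, Polynomial.X ^ i

theorem coeff_geomPoly (e k : ℕ) : (geomPoly e).coeff k = if k < e then 1 else 0 := by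
  simp [geomPoly, Polynomial.coeff_X_pow]

theorem geomPoly_mul (e : ℕ) : geomPoly e * (1 - Polynomial.X) = 1 - Polynomial.X ^ e :=
  geom_sum_mul_neg _ _

theorem monic_geomPoly {e : ℕ} (he : 0 < e) : (geomPoly e).Monic :=
  Polynomial.monic_geom_sum_X he.ne'

theorem natDegree_geomPoly (e : ℕ) : (geomPoly e).natDegree = e - 1 := by
  rcases Nat.eq_zero_or_pos e with rfl | he
  · simp [geomPoly]
  · refine Polynomial.natDegree_eq_of_le_of_coeff_ne_zero ?_ ?_
    · rw [Polynomial.natDegree_le_iff_coeff_eq_zero]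
      intro k hk
      rw [coeff_geomPoly, if_neg (by lia)]
    · rw [coeff_geomPoly, if_pos (by lia)]
      exact one_ne_zero

theorem reverse_geomPoly (e : ℕ) : (geomPoly e).reverse = geomPoly e := by
  ext k
  rw [Polynomial.coeff_reverse, natDegree_geomPoly]
  rcases le_or_gt k (e - 1) with hk | hk
  · rw [Polynomial.revAt_le hk, coeff_geomPoly, coeff_geomPoly]
    split_ifs <;> lia
  · rw [Polynomial.revAt_eq_self_of_lt hk]

theorem one_sub_X_pow_eq (e : ℕ) : (1 - PowerSeries.X ^ e : PowerSeries ℤ) =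
    (geomPoly e : PowerSeries ℤ) * (1 - PowerSeries.X) := by
  have h := congrArg (fun p : Polynomial ℤ => (p : PowerSeries ℤ)) (geomPoly_mul e)
  simpa using h.symm

variable {K : Type*} [Field K] {n : ℕ} {f : Fin n → MvPolynomial (Fin (n + 1)) K} {d : Fin n → ℕ}

/-- The members of a regular sequence of forms have positive degree. -/
theorem degree_pos_of_isRegular (hf : ∀ j, (f j).IsHomogeneous (d j))
    (hreg : IsRegular (MvPolynomial (Fin (n + 1)) K) (List.ofFn f)) (j : Fin n) : 0 < d j := by
  by_contra h0
  have hd : d j = 0 := by lia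
  have hfj := hf j
  rw [hd] at hfj
  have hC := totalDegree_eq_zero_iff_eq_C.mp (Nat.le_zero.mp hfj.totalDegree_le)
  have hne : Ideal.ofList (List.ofFn f) ≠ ⊤ := by
    intro htop
    refine hreg.top_ne_smul ?_
    rw [smul_eq_mul, Ideal.mul_top, htop]
  refine hne ((Ideal.eq_top_iff_one _).mpr ?_)
  have hmem : f j ∈ Ideal.ofList (List.ofFn f) :=
    Ideal.subset_span (List.mem_ofFn.mpr ⟨j, rfl⟩)
  by_cases hc : coeff 0 (f j) = 0
  · have h1 := (isWeaklyRegular_iff_Fin _ _).mp hreg.toIsWeaklyRegular ⟨j, by simp⟩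
    rw [smul_eq_mul, Ideal.mul_top, isSMulRegular_quotient_iff] at h1
    have h2 := h1 1 (by
      simp only [Fin.getElem_fin, List.getElem_ofFn, Fin.eta]
      rw [hC, hc, map_zero, zero_mul]
      exact Ideal.zero_mem _)
    exact Ideal.span_mono (fun x hx => List.mem_of_mem_take hx) h2
  · rw [hC] at hmem
    have := Ideal.mul_mem_left _ (C (coeff 0 (f j))⁻¹) hmem
    rwa [← map_mul, inv_mul_cancel₀ hc, map_one] at this

theorem quotientHilbertSeries_completeIntersection (hf : ∀ j, (f j).IsHomogeneous (d j))
    (hreg : IsWeaklyRegular (MvPolynomial (Fin (n + 1)) K) (List.ofFn f)) :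
    quotientHilbertSeries (Ideal.ofList (List.ofFn f)) * (1 - PowerSeries.X) =
      ((∏ j, geomPoly (d j) : Polynomial ℤ) : PowerSeries ℤ) := by
  have h := quotientHilbertSeries_ofList_ofFn hf hreg
  have h1 := one_sub_X_pow_mul_quotientHilbertSeries_bot (K := K) (n + 1)
  have h2 : (∏ j, (1 - PowerSeries.X ^ d j) : PowerSeries ℤ) =
      ((∏ j, geomPoly (d j) : Polynomial ℤ) : PowerSeries ℤ) * (1 - PowerSeries.X) ^ n := by
    simp_rw [one_sub_X_pow_eq]
    rw [Finset.prod_mul_distrib, Finset.prod_const, Finset.card_univ, Fintype.card_fin]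
    congr 1
    exact (map_prod (Polynomial.coeToPowerSeries.ringHom (R := ℤ)) _ _).symm
  rw [h, h2]
  linear_combination ((∏ j, geomPoly (d j) : Polynomial ℤ) : PowerSeries ℤ) * h1

theorem mem_maxIdealOfVars_of_mem_ofFn (hf : ∀ j, (f j).IsHomogeneous (d j)) (hd : ∀ j, 0 < d j) :
    ∀ r ∈ List.ofFn f, r ∈ maxIdealOfVars (Fin (n + 1)) K := by
  intro r hr
  obtain ⟨j, rfl⟩ := List.mem_ofFn.mp hr
  exact (hf j).mem_maxIdealOfVars (hd j)

/-- A complete intersection of `n` forms in `n + 1` variables has positive depth. -/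
theorem isSaturatedIdeal_completeIntersection (hf : ∀ j, (f j).IsHomogeneous (d j))
    (hd : ∀ j, 0 < d j)
    (hreg : IsWeaklyRegular (MvPolynomial (Fin (n + 1)) K) (List.ofFn f)) :
    IsSaturatedIdeal (Ideal.ofList (List.ofFn f)) := fun _ hy =>
  mem_of_forall_mul_mem_of_length_lt hreg (isWeaklyRegular_ofFn_X K (n + 1))
    (mem_maxIdealOfVars_of_mem_ofFn hf hd)
    (fun r hr => by
      obtain ⟨i, rfl⟩ := List.mem_ofFn.mp hr
      exact Ideal.subset_span ⟨i, rfl⟩) (by simp) hy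

theorem hasCyclicSocle_completeIntersection (hf : ∀ j, (f j).IsHomogeneous (d j))
    (hd : ∀ j, 0 < d j)
    (hreg : IsWeaklyRegular (MvPolynomial (Fin (n + 1)) K) (List.ofFn f))
    {h : MvPolynomial (Fin (n + 1)) K} {e : ℕ} (hh : h.IsHomogeneous e) (he : 0 < e)
    (hha : ∀ y, h * y ∈ Ideal.ofList (List.ofFn f) → y ∈ Ideal.ofList (List.ofFn f)) :
    HasCyclicSocle (maxIdealOfVars (Fin (n + 1)) K)
      (Ideal.ofList (List.ofFn f) ⊔ Ideal.span {h}) := by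
  rw [← Ideal.ofList_singleton, ← Ideal.ofList_append]
  refine hasCyclicSocle_of_isWeaklyRegular ((isWeaklyRegular_concat_iff _ _).mpr ⟨hreg, hha⟩)
    (isWeaklyRegular_ofFn_X K (n + 1)) (fun r hr => ?_) (ofList_ofFn_X K (n + 1)) (by simp)
  rcases List.mem_append.mp hr with hr | hr
  · exact mem_maxIdealOfVars_of_mem_ofFn hf hd r hr
  · rw [List.mem_singleton.mp hr]
    exact hh.mem_maxIdealOfVars he

theorem hilbertFn_completeIntersection_sup (hf : ∀ j, (f j).IsHomogeneous (d j))
    (hreg : IsWeaklyRegular (MvPolynomial (Fin (n + 1)) K) (List.ofFn f))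
    {h : MvPolynomial (Fin (n + 1)) K} {e : ℕ} (hh : h.IsHomogeneous e)
    (hha : ∀ y, h * y ∈ Ideal.ofList (List.ofFn f) → y ∈ Ideal.ofList (List.ofFn f)) (q : ℕ) :
    (hilbertFn (Ideal.ofList (List.ofFn f) ⊔ Ideal.span {h}) q : ℤ) =
      (geomPoly e * ∏ j, geomPoly (d j)).coeff q := by
  rw [← coeff_quotientHilbertSeries, quotientHilbertSeries_sup_span_singleton
    (isHomogeneous_ofList_ofFn hf) hh hha, one_sub_X_pow_eq, mul_assoc,
    mul_comm (1 - PowerSeries.X), quotientHilbertSeries_completeIntersection hf hreg,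
    ← Polynomial.coe_mul, Polynomial.coeff_coe]

theorem monic_prod_geomPoly (hd : ∀ j, 0 < d j) : (∏ j, geomPoly (d j)).Monic :=
  Polynomial.monic_prod_of_monic _ _ fun j _ => monic_geomPoly (hd j)

theorem natDegree_geomPoly_mul_prod (hd : ∀ j, 0 < d j) {e : ℕ} (he : 0 < e) :
    (geomPoly e * ∏ j, geomPoly (d j)).natDegree = (∑ j, (d j - 1)) + e - 1 := by
  rw [(monic_geomPoly he).natDegree_mul (monic_prod_geomPoly hd), natDegree_geomPoly,
    Polynomial.natDegree_prod_of_monic _ _ fun j _ => monic_geomPoly (hd j)]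
  simp_rw [natDegree_geomPoly]
  lia

/-- The socle degree of the complete intersection `S / (f₁, …, fₙ, h)`. -/
theorem hilbertFn_completeIntersection_sup_ne_zero (hf : ∀ j, (f j).IsHomogeneous (d j))
    (hd : ∀ j, 0 < d j)
    (hreg : IsWeaklyRegular (MvPolynomial (Fin (n + 1)) K) (List.ofFn f))
    {h : MvPolynomial (Fin (n + 1)) K} {e : ℕ} (hh : h.IsHomogeneous e) (he : 0 < e)
    (hha : ∀ y, h * y ∈ Ideal.ofList (List.ofFn f) → y ∈ Ideal.ofList (List.ofFn f)) :
    hilbertFn (Ideal.ofList (List.ofFn f) ⊔ Ideal.span {h}) ((∑ j, (d j - 1)) + e - 1) ≠ 0 := by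
  have h1 := hilbertFn_completeIntersection_sup hf hreg hh hha ((∑ j, (d j - 1)) + e - 1)
  rw [← natDegree_geomPoly_mul_prod hd he,
    ((monic_geomPoly he).mul (monic_prod_geomPoly hd)).coeff_natDegree,
    natDegree_geomPoly_mul_prod hd he] at h1
  intro h0
  rw [h0] at h1
  simp at h1

theorem hilbertFn_completeIntersection_sup_eq_zero (hf : ∀ j, (f j).IsHomogeneous (d j))
    (hd : ∀ j, 0 < d j)
    (hreg : IsWeaklyRegular (MvPolynomial (Fin (n + 1)) K) (List.ofFn f))
    {h : MvPolynomial (Fin (n + 1)) K} {e : ℕ} (hh : h.IsHomogeneous e) (he : 0 < e)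
    (hha : ∀ y, h * y ∈ Ideal.ofList (List.ofFn f) → y ∈ Ideal.ofList (List.ofFn f)) {q : ℕ}
    (hq : (∑ j, (d j - 1)) + e ≤ q) :
    hilbertFn (Ideal.ofList (List.ofFn f) ⊔ Ideal.span {h}) q = 0 := by
  have h1 := hilbertFn_completeIntersection_sup hf hreg hh hha q
  rw [Polynomial.coeff_eq_zero_of_natDegree_lt (by rw [natDegree_geomPoly_mul_prod hd he]; lia)]
    at h1
  exact_mod_cast h1

/-- The Hilbert function of a proper saturated ideal `I ⊇ (f₁, …, fₙ)` is constant and nonzero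
from degree `∑ (dⱼ - 1)` on. -/
theorem exists_hilbertFn_eq_const (hf : ∀ j, (f j).IsHomogeneous (d j)) (hd : ∀ j, 0 < d j)
    (hreg : IsWeaklyRegular (MvPolynomial (Fin (n + 1)) K) (List.ofFn f))
    {I : Ideal (MvPolynomial (Fin (n + 1)) K)}
    (hI : I.IsHomogeneous (homogeneousSubmodule (Fin (n + 1)) K)) (hsat : IsSaturatedIdeal I)
    (haI : Ideal.ofList (List.ofFn f) ≤ I) (hne : I ≠ ⊤) :
    ∃ μ : ℕ, μ ≠ 0 ∧ ∀ q ≥ ∑ j, (d j - 1), hilbertFn I q = μ := by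
  obtain ⟨E, hE⟩ := exists_isHomogeneous_regular
    (isSaturatedIdeal_completeIntersection hf hd hreg) hsat
  have hper : ∀ e, E ≤ e → 0 < e → ∀ q ≥ ∑ j, (d j - 1), hilbertFn I (e + q) = hilbertFn I q := by
    intro e he he0 q hq
    obtain ⟨h, hh, hha, hhI⟩ := hE e he
    have h1 := hilbertFn_add hI hh q
    have h2 : hilbertFn (I ⊔ Ideal.span {h}) (e + q) = 0 := by
      rw [hilbertFn_eq_zero_iff]
      intro y hy
      have h3 := hilbertFn_eq_zero_iff.mp (hilbertFn_completeIntersection_sup_eq_zero hf hd hreg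
        hh he0 hha (q := e + q) (by lia)) y hy
      exact sup_le_sup_right haI _ h3
    rw [h2, colon_singleton_eq_self hhI, zero_add] at h1
    exact h1
  have hstep : ∀ q ≥ ∑ j, (d j - 1), hilbertFn I (q + 1) = hilbertFn I q := by
    intro q hq
    have h1 := hper (E + 1) (by lia) (by lia) (q + 1) (by lia)
    have h2 := hper (E + 2) (by lia) (by lia) q hq
    rw [← h1, ← h2]
    congr 1
    lia
  have hconst : ∀ q ≥ ∑ j, (d j - 1), hilbertFn I q = hilbertFn I (∑ j, (d j - 1)) := by
    intro q hq
    induction q, hq using Nat.le_induction with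
    | base => rfl
    | succ q hq ih => rw [hstep q hq, ih]
  refine ⟨_, ?_, hconst⟩
  obtain ⟨h, hh, -, hhI⟩ := hE (E + ∑ j, (d j - 1)) (by lia)
  rw [← hconst (E + ∑ j, (d j - 1)) (by lia)]
  intro h0
  refine hne ((Ideal.eq_top_iff_one I).mpr (hhI 1 ?_))
  rw [mul_one]
  exact hilbertFn_eq_zero_iff.mp h0 h hh

/-- Duality over the one-dimensional complete intersection `R = S / (f₁, …, fₙ)`: the ideal
`(0 : g)` of `R` is a shifted dual of `S / I`, where `I` is the saturation of
`(f₁, …, fₙ, g)`. Here `μ` is the eventual value of the Hilbert function of `S / I`.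
Modulo a nonzerodivisor `h` of degree `e ≫ p`, it becomes the symmetry of the Hilbert function of
`S / ((f₁, …, fₙ, h) : g)`. -/
theorem hilbertFn_add_eq_hilbertFn_colon_add (hf : ∀ j, (f j).IsHomogeneous (d j))
    (hd : ∀ j, 0 < d j)
    (hreg : IsWeaklyRegular (MvPolynomial (Fin (n + 1)) K) (List.ofFn f))
    {g : MvPolynomial (Fin (n + 1)) K} {d₀ : ℕ} (hg : g.IsHomogeneous d₀)
    {J : Ideal (MvPolynomial (Fin (n + 1)) K)}
    (hJ : J = Ideal.ofList (List.ofFn f) ⊔ Ideal.span {g}) {μ : ℕ}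
    (hμ : ∀ q ≥ ∑ j, (d j - 1), hilbertFn (saturationIdeal J) q = μ) (p : ℕ) :
    hilbertFn ((Ideal.ofList (List.ofFn f)).colon {g}) p + μ =
      hilbertFn (Ideal.ofList (List.ofFn f)) p +
        if p < ∑ j, (d j - 1) then
          hilbertFn (saturationIdeal J) ((∑ j, (d j - 1)) - 1 - p) else 0 := by
  set c := ∑ j, (d j - 1) with hc
  set a := Ideal.ofList (List.ofFn f) with ha
  have haH : a.IsHomogeneous (homogeneousSubmodule (Fin (n + 1)) K) := isHomogeneous_ofList_ofFn hf
  have hJH : J.IsHomogeneous (homogeneousSubmodule (Fin (n + 1)) K) := by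
    rw [hJ]
    exact haH.sup (isHomogeneous_span_singleton hg)
  have hIH := isHomogeneous_saturationIdeal hJH
  obtain ⟨q₀, hq₀⟩ := exists_forall_mem_saturationIdeal_iff hJH
  obtain ⟨E, hE⟩ := exists_isHomogeneous_regular
    (isSaturatedIdeal_completeIntersection hf hd hreg) (isSaturatedIdeal_saturationIdeal J)
  obtain ⟨e, he⟩ : ∃ e, e = E + p + d₀ + q₀ + c + 1 := ⟨_, rfl⟩
  obtain ⟨h, hh, hha, hhI⟩ := hE e (by lia)
  have hLH : (a ⊔ Ideal.span {h}).IsHomogeneous (homogeneousSubmodule (Fin (n + 1)) K) :=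
    haH.sup (isHomogeneous_span_singleton hh)
  have hsoc := hasCyclicSocle_completeIntersection hf hd hreg hh (by lia) hha
  have hs := hilbertFn_completeIntersection_sup_ne_zero hf hd hreg hh (by lia) hha
  have htop := hilbertFn_completeIntersection_sup_eq_zero hf hd hreg hh (by lia) hha
    (q := c + e - 1 + 1) (by lia)
  obtain ⟨r, hr⟩ : ∃ r, d₀ + p + r = c + e - 1 := ⟨c + e - 1 - (d₀ + p), by lia⟩
  -- in degrees below `e`, nothing changes modulo `h`
  have h1 : hilbertFn (a.colon {g}) p = hilbertFn ((a ⊔ Ideal.span {h}).colon {g}) p := by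
    refine hilbertFn_congr fun y hy => ?_
    rw [Submodule.mem_colon_singleton, Submodule.mem_colon_singleton, smul_eq_mul,
      mem_sup_span_singleton_iff_of_lt haH hh (hy.mul hg) (by lia)]
  have h2 := hilbertFn_colon_symm hLH hsoc hs htop hg (p := p) (q := r) hr
  have h3 := hilbertFn_add hLH hg r
  have h4 : hilbertFn (a ⊔ Ideal.span {h}) (d₀ + r) = hilbertFn a p := by
    rw [hilbertFn_symm_of_hasCyclicSocle hLH hsoc hs htop (p := d₀ + r) (q := p) (by lia),
      hilbertFn_sup_of_lt haH hh (by lia)]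
  -- in the large degree `d₀ + r`, the ideal `J` may be replaced by its saturation
  have h5 : hilbertFn (a ⊔ Ideal.span {h} ⊔ Ideal.span {g}) (d₀ + r) =
      hilbertFn (saturationIdeal J ⊔ Ideal.span {h}) (d₀ + r) := by
    rw [sup_right_comm, ← hJ]
    refine hilbertFn_congr fun y hy => ?_
    rcases lt_or_ge (d₀ + r) e with hlt | hge
    · rw [mem_sup_span_singleton_iff_of_lt hJH hh hy hlt,
        mem_sup_span_singleton_iff_of_lt hIH hh hy hlt, hq₀ _ (by lia) y hy]
    · obtain ⟨t, ht⟩ := Nat.exists_eq_add_of_le hge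
      rw [ht] at hy
      rw [mem_sup_span_singleton_iff hJH hh hy, mem_sup_span_singleton_iff hIH hh hy]
      refine exists_congr fun b => and_congr_right fun hb => ?_
      rw [hq₀ (e + t) (by lia) _ (hy.sub (hh.mul hb))]
  have h6 : hilbertFn (saturationIdeal J ⊔ Ideal.span {h}) (d₀ + r) +
      (if p < c then hilbertFn (saturationIdeal J) (c - 1 - p) else 0) = μ := by
    split_ifs with hpc
    · have h7 := hilbertFn_add hIH hh (c - 1 - p)
      rw [colon_singleton_eq_self hhI, hμ _ (by lia)] at h7
      rw [h7, show d₀ + r = e + (c - 1 - p) by lia]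
    · rw [hilbertFn_sup_of_lt hIH hh (by lia), hμ _ (by lia), add_zero]
  rw [h5, h4] at h3
  rw [h1, h2]
  lia

/-- If `S / I` is Gorenstein, where `I` is a proper saturated homogeneous ideal containing a
complete intersection of dimension one, then the numerator of its Hilbert series is palindromic. -/
theorem reverse_eq_self_of_isGorensteinRing (hf : ∀ j, (f j).IsHomogeneous (d j))
    (hd : ∀ j, 0 < d j)
    (hreg : IsWeaklyRegular (MvPolynomial (Fin (n + 1)) K) (List.ofFn f))
    {I : Ideal (MvPolynomial (Fin (n + 1)) K)}
    (hI : I.IsHomogeneous (homogeneousSubmodule (Fin (n + 1)) K)) (hsat : IsSaturatedIdeal I)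
    (haI : Ideal.ofList (List.ofFn f) ≤ I) (hne : I ≠ ⊤)
    (hG : IsGorensteinRing (MvPolynomial (Fin (n + 1)) K ⧸ I)) {F : Polynomial ℤ}
    (hF : quotientHilbertSeries I * (1 - PowerSeries.X) = (F : PowerSeries ℤ)) (hF0 : F ≠ 0) :
    F.reverse = F := by
  obtain ⟨E, hE⟩ := exists_isHomogeneous_regular
    (isSaturatedIdeal_completeIntersection hf hd hreg) hsat
  obtain ⟨h, hh, hha, hhI⟩ := hE (E + 1) (by lia)
  have hIm : I ≤ maxIdealOfVars (Fin (n + 1)) K := by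
    intro y hy
    have h0 := homogeneousComponent_mem_of_mem hI hy 0
    rw [homogeneousComponent_zero] at h0
    have hy0 : coeff 0 y = 0 := by
      by_contra hc
      refine hne ((Ideal.eq_top_iff_one I).mpr ?_)
      have := Ideal.mul_mem_left _ (C (coeff 0 y)⁻¹) h0
      rwa [← map_mul, inv_mul_cancel₀ hc, map_one] at this
    have := (mem_pow_idealOfVars_iff' (σ := Fin (n + 1)) (R := K) 1 y).mpr fun x hx => by
      rw [Nat.lt_one_iff, Finsupp.degree_eq_zero_iff] at hx
      rw [hx, hy0]
    rwa [pow_one] at this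
  have hpow : maxIdealOfVars (Fin (n + 1)) K ^ ((∑ j, (d j - 1)) + (E + 1)) ≤
      I ⊔ Ideal.span {h} := by
    rw [show maxIdealOfVars (Fin (n + 1)) K = idealOfVars (Fin (n + 1)) K from rfl,
      pow_idealOfVars_eq_span, Ideal.span_le]
    rintro _ ⟨x, hx, rfl⟩
    have h1 := hilbertFn_eq_zero_iff.mp (hilbertFn_completeIntersection_sup_eq_zero hf hd hreg
        hh (by lia) hha le_rfl) _ (isHomogeneous_monomial 1 hx)
    exact sup_le_sup_right haI _ h1
  have hsoc := hG.hasCyclicSocle hIm hhI (hh.mem_maxIdealOfVars (by lia)) hpow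
  have hLH := hI.sup (isHomogeneous_span_singleton hh)
  have hser : quotientHilbertSeries (I ⊔ Ideal.span {h}) =
      ((geomPoly (E + 1) * F : Polynomial ℤ) : PowerSeries ℤ) := by
    rw [quotientHilbertSeries_sup_span_singleton hI hh hhI, one_sub_X_pow_eq, mul_assoc,
      mul_comm (1 - PowerSeries.X), hF, Polynomial.coe_mul]
  have hcoeff : ∀ q, (hilbertFn (I ⊔ Ideal.span {h}) q : ℤ) = (geomPoly (E + 1) * F).coeff q := by
    intro q
    rw [← coeff_quotientHilbertSeries, hser, Polynomial.coeff_coe]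
  have hgeom0 : geomPoly (E + 1) ≠ 0 := (monic_geomPoly (by lia)).ne_zero
  set Q := geomPoly (E + 1) * F with hQ
  have hQ0 : Q ≠ 0 := mul_ne_zero hgeom0 hF0
  have hs : hilbertFn (I ⊔ Ideal.span {h}) Q.natDegree ≠ 0 := by
    intro h0
    have h1 := hcoeff Q.natDegree
    rw [h0] at h1
    exact hQ0 (Polynomial.leadingCoeff_eq_zero.mp (by simpa using h1.symm))
  have htop : hilbertFn (I ⊔ Ideal.span {h}) (Q.natDegree + 1) = 0 := by
    have h1 := hcoeff (Q.natDegree + 1)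
    rw [Polynomial.coeff_eq_zero_of_natDegree_lt (by lia)] at h1
    exact_mod_cast h1
  have hrev : Q.reverse = Q := by
    ext k
    rw [Polynomial.coeff_reverse]
    rcases le_or_gt k Q.natDegree with hk | hk
    · rw [Polynomial.revAt_le hk, ← hcoeff, ← hcoeff, hilbertFn_symm_of_hasCyclicSocle hLH hsoc hs
        htop (p := Q.natDegree - k) (q := k) (by lia)]
    · rw [Polynomial.revAt_eq_self_of_lt hk]
  rw [hQ, Polynomial.reverse_mul_of_domain, reverse_geomPoly] at hrev
  exact mul_left_cancel₀ hgeom0 hrev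

end CompleteIntersection

/-! ### Numerators of Hilbert series -/

section Numerators

theorem toLaurent_geomPoly (e : ℕ) : Polynomial.toLaurent (geomPoly e) =
    ∑ k ∈ Finset.range e, LaurentPolynomial.T (k : ℤ) := by
  rw [geomPoly, map_sum]
  exact Finset.sum_congr rfl fun k _ => Polynomial.toLaurent_X_pow k

theorem toLaurent_reflect {c : ℕ} {F : Polynomial ℤ} (hF : F.natDegree ≤ c) :
    Polynomial.toLaurent (F.reflect c) =
      LaurentPolynomial.T (c : ℤ) * LaurentPolynomial.invert (Polynomial.toLaurent F) := by
  refine Polynomial.induction_with_natDegree_le (fun F => Polynomial.toLaurent (F.reflect c) =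
      LaurentPolynomial.T (c : ℤ) * LaurentPolynomial.invert (Polynomial.toLaurent F)) c
      (by simp) (fun m r _ hm => ?_) (fun p q _ _ hp hq => ?_) F hF
  · rw [Polynomial.reflect_C_mul_X_pow, Polynomial.revAt_le hm, Polynomial.toLaurent_C_mul_X_pow,
      Polynomial.toLaurent_C_mul_X_pow, map_mul, LaurentPolynomial.invert_C,
      LaurentPolynomial.invert_T, mul_left_comm, ← LaurentPolynomial.T_add, Nat.cast_sub hm,
      sub_eq_add_neg]
  · rw [Polynomial.reflect_add, map_add, hp, hq, map_add, map_add, mul_add]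

/-- The coefficients of the numerator `(1 - t) ∑ H(q) t ^ q`. -/
theorem coeff_mk_mul_one_sub_X (H : ℕ → ℤ) (q : ℕ) :
    PowerSeries.coeff q (PowerSeries.mk H * (1 - PowerSeries.X)) =
      H q - if q = 0 then 0 else H (q - 1) := by
  rw [mul_sub, mul_one, map_sub, PowerSeries.coeff_mk]
  cases q with
  | zero => simp
  | succ q => rw [PowerSeries.coeff_succ_mul_X, PowerSeries.coeff_mk]; simp

/-- If `H` is constant from degree `c` on, then `(1 - t) ∑ H(q) t ^ q` is a polynomial of degree at
most `c`, with value `H(c)` at `1`. -/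
theorem exists_polynomial_of_eventually_const {H : ℕ → ℤ} {c : ℕ} {μ : ℤ}
    (hH : ∀ q ≥ c, H q = μ) :
    ∃ F : Polynomial ℤ, PowerSeries.mk H * (1 - PowerSeries.X) = (F : PowerSeries ℤ) ∧
      F.natDegree ≤ c ∧ F.eval 1 = μ := by
  have hcoeff : ∀ q, (PowerSeries.trunc (c + 1) (PowerSeries.mk H * (1 - PowerSeries.X))).coeff q =
      PowerSeries.coeff q (PowerSeries.mk H * (1 - PowerSeries.X)) := by
    intro q
    rw [PowerSeries.coeff_trunc]
    split_ifs with hq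
    · rfl
    · rw [coeff_mk_mul_one_sub_X, if_neg (by lia), hH q (by lia), hH (q - 1) (by lia), sub_self]
  have hdeg : (PowerSeries.trunc (c + 1)
      (PowerSeries.mk H * (1 - PowerSeries.X))).natDegree < c + 1 :=
    PowerSeries.natDegree_trunc_lt _ _
  refine ⟨_, ?_, Nat.lt_succ_iff.mp hdeg, ?_⟩
  · ext q
    rw [Polynomial.coeff_coe, hcoeff]
  · have hsum : ∀ m, ∑ q ∈ Finset.range (m + 1),
        PowerSeries.coeff q (PowerSeries.mk H * (1 - PowerSeries.X)) = H m := by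
      intro m
      induction m with
      | zero => simp [coeff_mk_mul_one_sub_X]
      | succ m ih => rw [Finset.sum_range_succ, ih, coeff_mk_mul_one_sub_X]; simp
    rw [Polynomial.eval_eq_sum_range' hdeg]
    simp only [hcoeff, one_pow, mul_one]
    rw [hsum, hH c le_rfl]

/-- If `H` has the constant value `μ` from degree `c` on and `(1 - t) ∑ H(q) t ^ q = F(t)`, then
`p ↦ μ - H(c - 1 - p)` has numerator `t ^ c F(1 / t)`. -/
theorem mk_mul_one_sub_X_eq_reflect {H W : ℕ → ℤ} {c : ℕ} {μ : ℤ} (hH : ∀ q ≥ c, H q = μ)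
    {F : Polynomial ℤ} (hF : PowerSeries.mk H * (1 - PowerSeries.X) = (F : PowerSeries ℤ))
    (hW : ∀ p, W p = μ - if p < c then H (c - 1 - p) else 0) :
    PowerSeries.mk W * (1 - PowerSeries.X) = (F.reflect c : PowerSeries ℤ) := by
  ext i
  rw [Polynomial.coeff_coe, Polynomial.coeff_reflect, ← Polynomial.coeff_coe, ← hF,
    coeff_mk_mul_one_sub_X, coeff_mk_mul_one_sub_X, hW]
  rcases lt_trichotomy i c with hi | rfl | hi
  · rw [Polynomial.revAt_le hi.le, if_pos hi, if_neg (show c - i ≠ 0 by lia),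
      show c - i - 1 = c - 1 - i by lia]
    split_ifs with h0
    · rw [h0, hH (c - 0) (by lia)]
      ring
    · rw [hW, if_pos (by lia), show c - 1 - (i - 1) = c - i by lia]
      ring
  · rw [Polynomial.revAt_le le_rfl, if_neg (lt_irrefl _), Nat.sub_self, if_pos rfl]
    split_ifs with h0
    · rw [hH 0 (by lia), sub_zero]
    · rw [hW, if_pos (by lia), show i - 1 - (i - 1) = 0 by lia]
      ring
  · rw [Polynomial.revAt_eq_self_of_lt hi, hH i hi.le, if_neg (by lia), if_neg (by lia), hW,
      if_neg (by lia), if_neg (by lia), hH (i - 1) (by lia)]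
    ring

theorem eval_one_reflect {c : ℕ} {F : Polynomial ℤ} (hF : F.natDegree ≤ c) :
    (F.reflect c).eval 1 = F.eval 1 := by
  let _ : Invertible (1 : ℤ) := invertibleOne
  have h := Polynomial.eval₂_reflect_mul_pow (RingHom.id ℤ) 1 c F hF
  rwa [invOf_one, one_pow, mul_one] at h

end Numerators

attribute [local instance] MvPolynomial.gradedAlgebra in
theorem theorem1p4 {K : Type*} [Field K] (n : ℕ)
    (f : Fin (n + 1) → MvPolynomial (Fin (n + 1)) K) (d : Fin (n + 1) → ℕ)
    (hf : ∀ i, (f i).IsHomogeneous (d i))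
    (hreg : RingTheory.Sequence.IsRegular (MvPolynomial (Fin (n + 1)) K)
      (List.ofFn fun j : Fin n => f j.succ))
    (J : Ideal (MvPolynomial (Fin (n + 1)) K)) (hJ : J = Ideal.span (Set.range f))
    (hdim : ringKrullDim (MvPolynomial (Fin (n + 1)) K ⧸ J) = 1)
    (I : Ideal (MvPolynomial (Fin (n + 1)) K)) (hI : I = saturationIdeal J) :
    ∃ G F : Polynomial ℤ,
      quotientHilbertSeries J * (1 - PowerSeries.X) = (G : PowerSeries ℤ) ∧
      quotientHilbertSeries I * (1 - PowerSeries.X) = (F : PowerSeries ℤ) ∧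
      G.eval 1 ≠ 0 ∧ F.eval 1 ≠ 0 ∧
      Polynomial.toLaurent G =
        (1 - LaurentPolynomial.T (d 0 : ℤ)) *
            ∏ j : Fin n, ∑ k ∈ Finset.range (d j.succ), LaurentPolynomial.T (k : ℤ) +
          LaurentPolynomial.T ((∑ i, (d i : ℤ)) - (n : ℤ)) *
            LaurentPolynomial.invert (Polynomial.toLaurent F) ∧
      (IsGorensteinRing (MvPolynomial (Fin (n + 1)) K ⧸ I) →
        Polynomial.toLaurent G =
          (1 - LaurentPolynomial.T (d 0 : ℤ)) *
              ∏ j : Fin n, ∑ k ∈ Finset.range (d j.succ), LaurentPolynomial.T (k : ℤ) +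
            LaurentPolynomial.T ((∑ i, (d i : ℤ)) - (n : ℤ) - (F.natDegree : ℤ)) *
              Polynomial.toLaurent F) := by
  subst hI
  have hf' : ∀ j : Fin n, (f j.succ).IsHomogeneous (d j.succ) := fun j => hf j.succ
  have hd : ∀ j : Fin n, 0 < d j.succ := degree_pos_of_isRegular hf' hreg
  have hwreg := hreg.toIsWeaklyRegular
  set a := Ideal.ofList (List.ofFn fun j : Fin n => f j.succ) with ha
  have haH : a.IsHomogeneous (MvPolynomial.homogeneousSubmodule (Fin (n + 1)) K) :=
    isHomogeneous_ofList_ofFn hf'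
  have hJa : J = a ⊔ Ideal.span {f 0} := by
    rw [hJ, ha, Ideal.ofList, ← Ideal.span_union]
    congr 1
    ext x
    simp [List.mem_ofFn, Fin.exists_fin_succ, eq_comm]
  have hJH : J.IsHomogeneous (MvPolynomial.homogeneousSubmodule (Fin (n + 1)) K) := by
    rw [hJa]
    exact haH.sup (isHomogeneous_span_singleton (hf 0))
  have hIH := isHomogeneous_saturationIdeal hJH
  have haI : a ≤ saturationIdeal J := by
    refine le_trans ?_ (le_saturationIdeal J)
    rw [hJa]
    exact le_sup_left
  have hne := saturationIdeal_ne_top hdim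
  have hsat := isSaturatedIdeal_saturationIdeal J
  obtain ⟨μ, hμ0, hμ⟩ := exists_hilbertFn_eq_const hf' hd hwreg hIH hsat haI hne
  set c := ∑ j : Fin n, (d j.succ - 1) with hc
  obtain ⟨F, hF, hFc, hF1⟩ := exists_polynomial_of_eventually_const
    (H := fun q => (hilbertFn (saturationIdeal J) q : ℤ)) (c := c) (μ := μ)
    (fun q hq => by rw [hμ q hq])
  have hW := mk_mul_one_sub_X_eq_reflect (c := c) (μ := μ)
    (H := fun q => (hilbertFn (saturationIdeal J) q : ℤ)) (fun q hq => by rw [hμ q hq]) hF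
    (W := fun p => (hilbertFn a p : ℤ) - hilbertFn (a.colon {f 0}) p) (fun p => by
      have h := hilbertFn_add_eq_hilbertFn_colon_add hf' hd hwreg (hf 0) hJa hμ p
      rw [← ha, ← hc] at h
      split_ifs at h ⊢ <;> lia)
  have hF1' : F.eval 1 ≠ 0 := by
    rw [hF1]
    exact_mod_cast hμ0
  have hP := quotientHilbertSeries_completeIntersection hf' hwreg
  have hexp : (∑ i, (d i : ℤ)) - (n : ℤ) = d 0 + c := by
    have : ∀ j : Fin n, ((d j.succ - 1 : ℕ) : ℤ) = (d j.succ : ℤ) - 1 := fun j => by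
      have := hd j
      push_cast [this]
      lia
    rw [Fin.sum_univ_succ, hc, Nat.cast_sum, Finset.sum_congr rfl fun j _ => this j,
      Finset.sum_sub_distrib]
    simp
    ring
  have hG : Polynomial.toLaurent ((1 - Polynomial.X ^ d 0) * ∏ j : Fin n, geomPoly (d j.succ) +
      Polynomial.X ^ d 0 * F.reflect c) =
      (1 - LaurentPolynomial.T (d 0 : ℤ)) *
          ∏ j : Fin n, ∑ k ∈ Finset.range (d j.succ), LaurentPolynomial.T (k : ℤ) +
        LaurentPolynomial.T ((∑ i, (d i : ℤ)) - (n : ℤ)) *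
          LaurentPolynomial.invert (Polynomial.toLaurent F) := by
    rw [hexp, LaurentPolynomial.T_add, map_add, map_mul, map_mul, map_sub, map_one,
      Polynomial.toLaurent_X_pow, map_prod, toLaurent_reflect hFc, mul_assoc]
    simp_rw [toLaurent_geomPoly]
  refine ⟨_, F, ?_, hF, ?_, hF1', hG, fun hGor => ?_⟩
  · have h1 := quotientHilbertSeries_eq_add haH (hf 0)
    rw [← hJa] at h1
    have h2 : PowerSeries.mk (fun p => (hilbertFn a p : ℤ) - hilbertFn (a.colon {f 0}) p) =
        quotientHilbertSeries a - quotientHilbertSeries (a.colon {f 0}) := by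
      ext p
      rw [map_sub, coeff_quotientHilbertSeries, coeff_quotientHilbertSeries, PowerSeries.coeff_mk]
    rw [h2] at hW
    push_cast at hP ⊢
    rw [← hP, ← hW]
    linear_combination (PowerSeries.X - 1) * h1
  · rw [Polynomial.eval_add, Polynomial.eval_mul, Polynomial.eval_mul, eval_one_reflect hFc]
    simpa using hF1'
  · have hF0 : F ≠ 0 := by
      rintro rfl
      simp at hF1'
    have hrev := reverse_eq_self_of_isGorensteinRing hf' hd hwreg hIH hsat haI hne hGor hF hF0
    have h1 := LaurentPolynomial.toLaurent_reverse F
    rw [hrev] at h1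
    have h2 : LaurentPolynomial.T ((∑ i, (d i : ℤ)) - (n : ℤ) - (F.natDegree : ℤ)) *
        Polynomial.toLaurent F = LaurentPolynomial.T ((∑ i, (d i : ℤ)) - (n : ℤ)) *
          LaurentPolynomial.invert (Polynomial.toLaurent F) := by
      conv_lhs => rw [h1]
      rw [mul_left_comm, ← LaurentPolynomial.T_add, sub_add_cancel, mul_comm]
    rw [hG, h2]
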